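/- **Setting.** Let $\mathcal A$ be a finite alphabet with $n=\#\mathcal A$ letters. A *pair* on $\mathcal A$ is $\mathbf p=(p_0,p_1)$ with bijections $p_0,p_1:\mathcal A\to\{1,\dots,n\}$ (the two *rows*). It is *irreducible* if for $1\le k\le n$ one has $p_0^{-1}\{1,\dots,k\}=p_1^{-1}\{1,\dots,k\}$ if and only if $k=n$. For $\varepsilon\in\{0,1\}$ the *Rauzy move* of type $\varepsilon$ sends an irreducible $\mathbf p$ to $\mathbf p'$ with $p'_\varepsilon=p_\varepsilon$ and, with $z=p_\varepsilon^{-1}(n)$, $$p'_{1-\varepsilon}(b)=\begin{cases}p_{1-\varepsilon}(b), & p_{1-\varepsilon}(b)\le p_{1-\varepsilon}(z),\\ p_{1-\varepsilon}(b)+1, & p_{1-\varepsilon}(z)<p_{1-\varepsilon}(b)<n,\\ p_{1-\varepsilon}(z)+1, & p_{1-\varepsilon}(z)<p_{1-\varepsilon}(b)=n.\end{cases}$$ For $n\ge 2$, the *left Rauzy move* of type $\varepsilon$ sends $\mathbf p$ to $\mathbf p'$ with $p'_\varepsilon=p_\varepsilon$ and, with $a=p_\varepsilon^{-1}(1)$,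 $$p'_{1-\varepsilon}(b)=\begin{cases}p_{1-\varepsilon}(a)-1, & p_{1-\varepsilon}(b)=1,\\ p_{1-\varepsilon}(b)-1, & 1<p_{1-\varepsilon}(b)<p_{1-\varepsilon}(a),\\ p_{1-\varepsilon}(b), & p_{1-\varepsilon}(b)\ge p_{1-\varepsilon}(a).\end{cases}$$ The *(labeled) Extended Rauzy Class* of an irreducible pair $\mathbf p$ is its class under the smallest equivalence relation on irreducible pairs on $\mathcal A$ that relates every pair to its images under the Rauzy moves and left Rauzy moves of both types. An irreducible pair is *standard* if $p_0^{-1}(1)=p_1^{-1}(n)$ and $p_1^{-1}(1)=p_0^{-1}(n)$. A standard pair is *piece-wise order reversing* if there are $2=k_0<k_1<\dots<k_\ell=n$ such that for each $1\le i\le \ell$ one has $p_0^{-1}\{k_{i-1},\dots,k_i-1\}=p_1^{-1}\{k_{i-1},\dots,k_i-1\}$, and $p_0(b)+p_1(b)=k_{i-1}+k_i-1$ for each letter $b$ of this set. The set is then called a *block*, and a *$k$-block* if it has $k$ letters. The $1$-blocks cut the left-to-right sequence of blocks into (possibly empty) *chains* of consecutive blocks of size at least $2$: the blocks before the first $1$-block,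 those between two successive $1$-blocks, and those after the last $1$-block. A piece-wise order reversing pair is of * *Type $\langle 1\rangle$* if there is at most one non-empty chain, and this chain, if it exists, consists of one block; * *Type $\langle 2\rangle$* if every non-empty chain consists of $2$-blocks; * *Type $\langle 3\rangle$* if every non-empty chain either (i) consists of $m\ge0$ consecutive $2$-blocks, then one $3$-block, then $l\ge0$ consecutive $2$-blocks, or (ii) consists of $2$-blocks only, and at least one chain is of form (i); * *Type $\langle 4\rangle$* if exactly one chain consists of a $4$-block followed by $m\ge 0$ consecutive $2$-blocks and every other non-empty chain consists of $2$-blocks; * *Type $\langle 5\rangle$* if exactly one chain consists of a single $5$-block and every other non-empty chain consists of exactly one $2$-block; where Types $\langle2\rangle$–$\langle5\rangle$ require in addition that the pair has more than one block of size at least $2$. **Theorem.** Let $\mathbf p$ be an irreducible pair on $\mathcal A$ of Type $\langle x\rangle$, and let $\mathbf q$ be a pair of Type $\langle y\rangle$ in the (labeled) Extended Rauzy Class of $\mathbf p$, where $x,y\in\{1,2,3,4,5\}$. Then $x=y$. -/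

import Mathlib

/-- A pair `(p₀, p₁)` on the finite alphabet `A`: two bijections `p₀, p₁ : A → {1, …, #A}`. -/
@[ext]
structure RPair (A : Type*) [Fintype A] where
  /-- `pos ε b` is the position `p_ε(b)` of the letter `b` in row `ε`. -/
  pos : Fin 2 → A → ℕ
  bij : ∀ ε, Set.BijOn (pos ε) Set.univ (Set.Icc 1 (Fintype.card A))

namespace RPair

variable {A : Type*} [Fintype A]

/-- A pair is irreducible if, for `1 ≤ k ≤ #A`, the first `k` letters of the two rows agree as sets
exactly when `k = #A`. -/
def IsIrreducible (p : RPair A) : Prop :=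
  ∀ k : ℕ, 1 ≤ k → k ≤ Fintype.card A →
    ({b : A | p.pos 0 b ≤ k} = {b : A | p.pos 1 b ≤ k} ↔ k = Fintype.card A)

/-- `p'` is the result `εp` of the (right) Rauzy move of type `ε` on `p`; here `z` is the last letter
of row `ε`. -/
def IsRauzyMove (ε : Fin 2) (p p' : RPair A) : Prop :=
  p'.pos ε = p.pos ε ∧
  ∀ z : A, p.pos ε z = Fintype.card A → ∀ b : A,
    p'.pos (1 - ε) b =
      if p.pos (1 - ε) b ≤ p.pos (1 - ε) z then p.pos (1 - ε) b
      else if p.pos (1 - ε) b < Fintype.card A then p.pos (1 - ε) b + 1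
      else p.pos (1 - ε) z + 1

/-- `p'` is the result of the left Rauzy move of type `ε` on `p`; here `a` is the first letter
of row `ε`. -/
def IsLeftRauzyMove (ε : Fin 2) (p p' : RPair A) : Prop :=
  p'.pos ε = p.pos ε ∧
  ∀ a : A, p.pos ε a = 1 → ∀ b : A,
    p'.pos (1 - ε) b =
      if p.pos (1 - ε) b = 1 then p.pos (1 - ε) a - 1
      else if p.pos (1 - ε) b < p.pos (1 - ε) a then p.pos (1 - ε) b - 1
      else p.pos (1 - ε) b

end RPair

/-- The set of irreducible pairs on `A`. -/
def IrrPair (A : Type*) [Fintype A] : Type _ := {p : RPair A // p.IsIrreducible}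

namespace IrrPair

variable {A : Type*} [Fintype A]

/-- `q` is obtained from `p` by one Rauzy move or one left Rauzy move. -/
def Step (p q : IrrPair A) : Prop :=
  ∃ ε : Fin 2, RPair.IsRauzyMove ε p.1 q.1 ∨ RPair.IsLeftRauzyMove ε p.1 q.1

/-- The labeled extended Rauzy class of `p`: the class of `p` under the smallest equivalence relation
on the irreducible pairs that relates each pair to its images under the Rauzy moves and the left
Rauzy moves. -/
def extendedRauzyClass (p : IrrPair A) : Set (IrrPair A) :=
  {q | Relation.EqvGen Step p q}

end IrrPair

namespace RPair

variable {A : Type*} [Fintype A]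

/-- A standard pair: an irreducible pair such that the first letter of each row is the last letter of
the other row. -/
def IsStandard (p : RPair A) : Prop :=
  p.IsIrreducible ∧
  (∀ b : A, p.pos 0 b = 1 ↔ p.pos 1 b = Fintype.card A) ∧
  (∀ b : A, p.pos 1 b = 1 ↔ p.pos 0 b = Fintype.card A)

/-- The break point `k_i = 2 + s₁ + ⋯ + s_i` of a list `L = [s₁, …, s_ℓ]` of block sizes. -/
def breakPoint (L : List ℕ) (i : ℕ) : ℕ := 2 + (L.take i).sum

/-- `p` is piece-wise order reversing, and `L` lists the sizes of its order reversing blocks from left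
to right: with `k_i = breakPoint L i` we have `2 = k_0 < k_1 < ⋯ < k_ℓ = #A`, both rows have the same
letters in the positions `k_i, …, k_{i+1} - 1`, and these letters appear in reversed order. -/
def IsPiecewiseOrderReversing (p : RPair A) (L : List ℕ) : Prop :=
  p.IsStandard ∧
  (∀ s ∈ L, 0 < s) ∧
  breakPoint L L.length = Fintype.card A ∧
  ∀ i < L.length,
    {b : A | breakPoint L i ≤ p.pos 0 b ∧ p.pos 0 b < breakPoint L (i + 1)} =
      {b : A | breakPoint L i ≤ p.pos 1 b ∧ p.pos 1 b < breakPoint L (i + 1)} ∧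
    ∀ b : A, breakPoint L i ≤ p.pos 0 b → p.pos 0 b < breakPoint L (i + 1) →
      p.pos 0 b + p.pos 1 b = breakPoint L i + breakPoint L (i + 1) - 1

/-- The chain decomposition `C_1, …, C_k`: the (possibly empty) lists of blocks, each block given by
its size, between consecutive `1`-blocks. -/
def chains (L : List ℕ) : List (List ℕ) := L.splitOn 1

/-- More than one block has size two or greater. -/
def ManyBlocks (L : List ℕ) : Prop := 2 ≤ (L.filter (fun s => 2 ≤ s)).length

/-- Every block in the chain is a `2`-block. -/
def TwoChain (C : List ℕ) : Prop := ∀ s ∈ C, s = 2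

/-- The chain is `m ≥ 0` consecutive `2`-blocks, then a `3`-block, then `l ≥ 0` consecutive
`2`-blocks. -/
def ThreeChain (C : List ℕ) : Prop :=
  ∃ m l : ℕ, C = List.replicate m 2 ++ 3 :: List.replicate l 2

/-- The chain is a `4`-block followed by `m ≥ 0` consecutive `2`-blocks. -/
def FourChain (C : List ℕ) : Prop := ∃ m : ℕ, C = 4 :: List.replicate m 2

/-- The condition for Type `<x>` on the list of block sizes. -/
def TypeCondition : ℕ → List ℕ → Prop
  | 1, L => ((chains L).filter (fun C => C ≠ [])).length ≤ 1 ∧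
      ∀ C ∈ chains L, C ≠ [] → C.length = 1
  | 2, L => ManyBlocks L ∧ ∀ C ∈ chains L, C ≠ [] → TwoChain C
  | 3, L => ManyBlocks L ∧ (∀ C ∈ chains L, C ≠ [] → ThreeChain C ∨ TwoChain C) ∧
      ∃ C ∈ chains L, ThreeChain C
  | 4, L => ManyBlocks L ∧ ∃ (X Y : List (List ℕ)) (C : List ℕ),
      chains L = X ++ C :: Y ∧ FourChain C ∧ ∀ D ∈ X ++ Y, D ≠ [] → TwoChain D
  | 5, L => ManyBlocks L ∧ ∃ X Y : List (List ℕ),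
      chains L = X ++ [5] :: Y ∧ ∀ D ∈ X ++ Y, D ≠ [] → D = [2]
  | _, _ => False

/-- `p` is a piece-wise order reversing pair of Type `<x>`, `x ∈ {1, 2, 3, 4, 5}`. -/
def HasType (p : RPair A) (x : ℕ) : Prop :=
  ∃ L : List ℕ, p.IsPiecewiseOrderReversing L ∧ TypeCondition x L

end RPair

/-! The proof attaches three invariants of the extended Rauzy class to a pair and evaluates them on
block pairs. Exchanging the rows turns one type of move into the other and reflecting both rows
turns left moves into right ones, so invariance need only be checked for these two symmetries and
for one right move (`eq_of_mem_extendedRauzyClass`).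

Two invariants depend only on which letters cross. Read the crossing relation as an alternating form
over F_2 with the letters as basis. A right move with winner z and loser w, which cross, replaces
the basis vector w by w + z (`RightMove.slide`). (1) Crossing may be parity of intersection for
edges of a multigraph (`IsLineGraph`). The sum of two edges sharing one vertex is again an edge, so
this property persists. It holds with at most one block of size at least 2 and fails with two, which
isolates Type 1. (2) Let q be the quadratic form with this polar form and value 1 on every letter.
Then q(w + z) = 1 + 1 + 1 = 1, so the new basis has the same property and the Gauss sum of (-1)^q,
an Arf-type invariant, is unchanged. On a block pair it is -2 times a product over the blocks, with
factors 2, 2, 0, -4, -8 for sizes 1, ..., 5. The sign of the product separates Types 2, 3 and {4,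
5}.

(3) The number of points of angle 2π (`markedPoints`) equals the number of empty chains of a block
pair. Together with the number of letters and the exact Gauss sum it separates Type 4 from Type 5
(`not_typeCondition_four_and_five`). -/

namespace RPair

/-! ### Rows, reflection, and reduction to right moves. -/

/-- `r` numbers the letters of `A` bijectively by `1, …, n`. -/
def IsRow {A : Type*} (n : ℕ) (r : A → ℕ) : Prop := Set.BijOn r Set.univ (Set.Icc 1 n)

namespace IsRow

variable {A : Type*} {n : ℕ} {r : A → ℕ}

theorem one_le (h : IsRow n r) (b : A) : 1 ≤ r b := (h.mapsTo (Set.mem_univ b)).1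

theorem le (h : IsRow n r) (b : A) : r b ≤ n := (h.mapsTo (Set.mem_univ b)).2

theorem inj (h : IsRow n r) {b c : A} (e : r b = r c) : b = c :=
  h.injOn (Set.mem_univ b) (Set.mem_univ c) e

theorem exists_eq (h : IsRow n r) {k : ℕ} (h1 : 1 ≤ k) (h2 : k ≤ n) : ∃ b, r b = k := by
  obtain ⟨b, -, hb⟩ := h.surjOn (show k ∈ Set.Icc 1 n from ⟨h1, h2⟩)
  exact ⟨b, hb⟩

end IsRow

/-- The row `r` read from right to left. -/
def reflect {A : Type*} (n : ℕ) (r : A → ℕ) (b : A) : ℕ := n + 1 - r b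

theorem IsRow.reflect {A : Type*} {n : ℕ} {r : A → ℕ} (h : IsRow n r) :
    IsRow n (reflect n r) := by
  refine ⟨fun b _ => ?_, fun b _ c _ e => ?_, fun k hk => ?_⟩
  · have := h.one_le b; have := h.le b
    simp only [RPair.reflect, Set.mem_Icc]; omega
  · have := h.one_le b; have := h.le b; have := h.one_le c; have := h.le c
    simp only [RPair.reflect] at e
    exact h.inj (by omega)
  · obtain ⟨h1, h2⟩ := hk
    obtain ⟨b, hb⟩ := h.exists_eq (k := n + 1 - k) (by omega) (by omega)
    exact ⟨b, Set.mem_univ b, by simp only [RPair.reflect]; omega⟩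

/-- The row `s'` arises from `s` by the right Rauzy move won by the last letter of `r`. -/
def RightMove {A : Type*} (n : ℕ) (r s s' : A → ℕ) : Prop :=
  ∀ z, r z = n → ∀ b, s' b = if s b ≤ s z then s b else if s b < n then s b + 1 else s z + 1

/-- Take k = n - 1: a letter that is last in both rows is preceded by the same n - 1 letters in
each. Together with `IsIrreducible.first_ne`, this is all the invariants need from irreducibility.
-/
theorem IsIrreducible.last_ne {A : Type*} [Fintype A] {p : RPair A} (h : p.IsIrreducible)
    (hn : 2 ≤ Fintype.card A) (z : A) :
    ¬(p.pos 0 z = Fintype.card A ∧ p.pos 1 z = Fintype.card A) := by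
  rintro ⟨h0, h1⟩
  have r0 : IsRow _ (p.pos 0) := p.bij 0
  have r1 : IsRow _ (p.pos 1) := p.bij 1
  have key : ∀ {r : A → ℕ}, IsRow (Fintype.card A) r → r z = Fintype.card A →
      ∀ b, r b ≤ Fintype.card A - 1 ↔ b ≠ z := by
    intro r hr hz b
    refine ⟨fun hb e => ?_, fun hb => ?_⟩
    · subst e; omega
    · have := hr.le b
      have : r b ≠ r z := fun e => hb (hr.inj e)
      omega
  have := (h (Fintype.card A - 1) (by omega) (by omega)).1
    (by ext b; simp only [Set.mem_ofPred_eq, key r0 h0, key r1 h1])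
  omega

theorem IsIrreducible.first_ne {A : Type*} [Fintype A] {p : RPair A} (h : p.IsIrreducible)
    (hn : 2 ≤ Fintype.card A) (a : A) : ¬(p.pos 0 a = 1 ∧ p.pos 1 a = 1) := by
  rintro ⟨h0, h1⟩
  have r0 : IsRow _ (p.pos 0) := p.bij 0
  have r1 : IsRow _ (p.pos 1) := p.bij 1
  have key : ∀ {r : A → ℕ}, IsRow (Fintype.card A) r → r a = 1 →
      ∀ b, r b ≤ 1 ↔ b = a := by
    intro r hr hz b
    refine ⟨fun hb => hr.inj ?_, fun hb => by rw [hb, hz]⟩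
    have := hr.one_le b
    omega
  have := (h 1 le_rfl (by omega)).1
    (by ext b; simp only [Set.mem_ofPred_eq, key r0 h0, key r1 h1])
  omega

/-- A quantity attached to two rows that does not change when the rows are exchanged, when both rows
are reflected, and under right Rauzy moves, is constant on extended Rauzy classes. -/
theorem eq_of_mem_extendedRauzyClass {A β : Type*} [Fintype A] (hn : 2 ≤ Fintype.card A)
    (I : (A → ℕ) → (A → ℕ) → β)
    (swap : ∀ r s, IsRow (Fintype.card A) r → IsRow (Fintype.card A) s → I r s = I s r)
    (refl : ∀ r s, IsRow (Fintype.card A) r → IsRow (Fintype.card A) s →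
      I (reflect (Fintype.card A) r) (reflect (Fintype.card A) s) = I r s)
    (move : ∀ r s s', IsRow (Fintype.card A) r → IsRow (Fintype.card A) s →
      IsRow (Fintype.card A) s' → (∀ z, ¬(r z = Fintype.card A ∧ s z = Fintype.card A)) →
      RightMove (Fintype.card A) r s s' → I r s = I r s')
    (p q : IrrPair A) (h : q ∈ IrrPair.extendedRauzyClass p) :
    I (p.1.pos 0) (p.1.pos 1) = I (q.1.pos 0) (q.1.pos 1) := by
  -- Reflecting both rows turns a left move into a right move.
  have left : ∀ r s s', IsRow (Fintype.card A) r → IsRow (Fintype.card A) s →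
      IsRow (Fintype.card A) s' → (∀ a, ¬(r a = 1 ∧ s a = 1)) →
      (∀ a : A, r a = 1 → ∀ b : A, s' b =
        if s b = 1 then s a - 1 else if s b < s a then s b - 1 else s b) → I r s = I r s' := by
    intro r s s' hr hs hs' hne hm
    rw [← refl r s hr hs, ← refl r s' hr hs']
    refine move _ _ _ hr.reflect hs.reflect hs'.reflect ?_ ?_
    · rintro z ⟨h1, h2⟩
      have := hr.one_le z; have := hs.one_le z; have := hr.le z; have := hs.le z
      simp only [reflect] at h1 h2
      exact hne z ⟨by omega, by omega⟩
    · intro a ha b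
      have := hr.one_le a; have := hr.le a
      simp only [reflect] at ha
      have ha' : r a = 1 := by omega
      have hb := hm a ha' b
      have := hne a
      have := hs.one_le a; have := hs.le a; have := hs.one_le b; have := hs.le b
      have hs'b := hs'.one_le b; have := hs'.le b
      split_ifs at hb <;> split_ifs <;> simp only [reflect] at * <;> omega
  induction h with
  | refl => rfl
  | symm _ _ _ ih => exact ih.symm
  | trans _ _ _ _ _ ih1 ih2 => exact ih1.trans ih2
  | rel x y hxy =>
    have x0 : IsRow _ (x.1.pos 0) := x.1.bij 0
    have x1 : IsRow _ (x.1.pos 1) := x.1.bij 1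
    have y0 : IsRow _ (y.1.pos 0) := y.1.bij 0
    have y1 : IsRow _ (y.1.pos 1) := y.1.bij 1
    obtain ⟨ε, ⟨he, hm⟩ | ⟨he, hm⟩⟩ := hxy
    · fin_cases ε
      · simp only [Fin.zero_eta, Fin.isValue, sub_zero] at he hm
        rw [he]
        exact move _ _ _ x0 x1 y1 (x.2.last_ne hn) hm
      · simp only [Fin.mk_one, Fin.isValue, sub_self] at he hm
        rw [swap _ _ x0 x1, swap _ _ y0 y1, he]
        exact move _ _ _ x1 x0 y0 (fun z hz => x.2.last_ne hn z hz.symm) hm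
    · fin_cases ε
      · simp only [Fin.zero_eta, Fin.isValue, sub_zero] at he hm
        rw [he]
        exact left _ _ _ x0 x1 y1 (x.2.first_ne hn) hm
      · simp only [Fin.mk_one, Fin.isValue, sub_self] at he hm
        rw [swap _ _ x0 x1, swap _ _ y0 y1, he]
        exact left _ _ _ x1 x0 y0 (fun z hz => x.2.first_ne hn z hz.symm) hm

/-! ### The crossing relation and its change under a right move. -/

/-- The letters `b` and `c` appear in opposite orders in the two rows. -/
def Cross {A : Type*} (r s : A → ℕ) (b c : A) : Prop :=
  (r b < r c ∧ s c < s b) ∨ (r c < r b ∧ s b < s c)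

section Cross

variable {A : Type*} {n : ℕ} {r s s' : A → ℕ}

theorem cross_comm {b c : A} : Cross r s b c ↔ Cross r s c b := by
  unfold Cross; tauto

theorem cross_swap {b c : A} : Cross s r b c ↔ Cross r s b c := by
  unfold Cross; tauto

theorem cross_reflect (hr : IsRow n r) (hs : IsRow n s) {b c : A} :
    Cross (reflect n r) (reflect n s) b c ↔ Cross r s b c := by
  have := hr.le b; have := hr.le c; have := hs.le b; have := hs.le c
  unfold Cross reflect; omega

/-- The relation `Y` arises from `X` by replacing the loser `w` by its sum with the winner `z`. -/
structure Slide (X Y : A → A → Prop) (w z : A) : Prop where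
  ne : w ≠ z
  cross : X w z
  cross' : Y w z
  off : ∀ b c, b ≠ w → c ≠ w → (Y b c ↔ X b c)
  loser : ∀ b, b ≠ w → b ≠ z → (Y w b ↔ ¬(X w b ↔ X z b))

theorem Slide.symm {X Y : A → A → Prop} {w z : A} (h : Slide X Y w z) : Slide Y X w z where
  ne := h.ne
  cross := h.cross'
  cross' := h.cross
  off b c hb hc := (h.off b c hb hc).symm
  loser b hb hz := by
    have h1 := h.loser b hb hz
    have h2 := h.off z b h.ne.symm hb
    tauto

/-- Since `z` is last in `r`, the other letters crossing `z` are exactly those to its right in `s`.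
These are the letters, apart from `w`, that the loser `w` jumps over, so precisely its crossings
with them flip. -/
theorem RightMove.slide (hr : IsRow n r) (hs : IsRow n s)
    (hne : ∀ z, ¬(r z = n ∧ s z = n)) (h : RightMove n r s s') (hn : 1 ≤ n) :
    ∃ w z, Slide (Cross r s) (Cross r s') w z := by
  obtain ⟨z, hz⟩ := hr.exists_eq hn le_rfl
  obtain ⟨w, hw⟩ := hs.exists_eq hn le_rfl
  have hwz : w ≠ z := by rintro rfl; exact hne _ ⟨hz, hw⟩
  have lr : ∀ b, b ≠ z → r b < n := fun b hb =>
    lt_of_le_of_ne (hr.le b) fun e => hb (hr.inj (e.trans hz.symm))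
  have ls : ∀ b, b ≠ w → s b < n := fun b hb =>
    lt_of_le_of_ne (hs.le b) fun e => hb (hs.inj (e.trans hw.symm))
  have sw : s' w = s z + 1 := by
    have h1 := h z hz w; have := ls z hwz.symm
    rwa [if_neg (by omega), if_neg (by omega)] at h1
  have sb : ∀ b, b ≠ w → s' b = if s b ≤ s z then s b else s b + 1 := by
    intro b hb
    have h1 := h z hz b; have h2 := ls b hb
    rw [h1]; split_ifs <;> rfl
  have sz := sb z hwz.symm
  rw [if_pos le_rfl] at sz
  have rw' := lr w hwz
  have szn := ls z hwz.symm
  refine ⟨w, z, hwz, ?_, ?_, ?_, ?_⟩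
  · unfold Cross; omega
  · unfold Cross; omega
  · intro b c hb hc
    have h1 := sb b hb; have h2 := sb c hc
    unfold Cross
    split_ifs at h1 h2 <;> omega
  · intro b hb hbz
    have h1 := sb b hb; have h2 := ls b hb; have h3 := lr b hbz
    have h4 : s b ≠ s z := fun e => hbz (hs.inj e)
    have h5 : r b ≠ r w := fun e => hb (hr.inj e)
    unfold Cross
    split_ifs at h1 <;> omega

end Cross

/-! ### First invariant: representability by edges of a multigraph. -/

/-- The letters can be represented by edges of a multigraph such that two letters cross exactly when
their edges share precisely one vertex. -/
def IsLineGraph {A : Type*} (X : A → A → Prop) : Prop :=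
  ∃ f : A → Finset ℕ, (∀ b, (f b).card = 2) ∧ ∀ b c, b ≠ c → (X b c ↔ Odd (f b ∩ f c).card)

/-- Bilinearity over F_2 of the parity of an intersection. -/
theorem odd_card_symmDiff_inter (s t u : Finset ℕ) :
    Odd ((symmDiff s t) ∩ u).card ↔ ¬(Odd (s ∩ u).card ↔ Odd (t ∩ u).card) := by
  have h1 : (symmDiff s t) ∩ u = (s ∩ u) \ (t ∩ u) ∪ (t ∩ u) \ (s ∩ u) := by
    ext x
    simp only [Finset.mem_inter, Finset.mem_symmDiff, Finset.mem_union, Finset.mem_sdiff]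
    tauto
  have h2 : Disjoint ((s ∩ u) \ (t ∩ u)) ((t ∩ u) \ (s ∩ u)) := disjoint_sdiff_sdiff
  have h3 := Finset.card_sdiff_add_card_inter (s ∩ u) (t ∩ u)
  have h4 := Finset.card_sdiff_add_card_inter (t ∩ u) (s ∩ u)
  rw [Finset.inter_comm (t ∩ u)] at h4
  rw [h1, Finset.card_union_of_disjoint h2]
  simp only [Nat.odd_iff]; omega

/-- The edges of `w` and `z` share exactly one vertex, so their symmetric difference is again an
edge. It represents the new `w`; all other edges stay. -/
theorem Slide.isLineGraph {A : Type*} {X Y : A → A → Prop} {w z : A} (h : Slide X Y w z)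
    (hY : ∀ b c, Y b c ↔ Y c b) (hl : IsLineGraph X) :
    IsLineGraph Y := by
  classical
  obtain ⟨f, hf, hc⟩ := hl
  have hwz : (f w ∩ f z).card = 1 := by
    have h1 := (hc w z h.ne).1 h.cross
    have h2 := Finset.card_le_card (Finset.inter_subset_left (s₁ := f w) (s₂ := f z))
    rw [hf] at h2
    rw [Nat.odd_iff] at h1; omega
  have loser : ∀ b, b ≠ w → (Y w b ↔ Odd (symmDiff (f w) (f z) ∩ f b).card) := by
    intro b hb
    rw [odd_card_symmDiff_inter]
    by_cases hz : b = z
    · subst hz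
      simp only [h.cross', Finset.inter_self, hf, hwz, true_iff]; decide
    · rw [h.loser b hb hz, hc w b hb.symm, hc z b (Ne.symm hz)]
  refine ⟨Function.update f w (symmDiff (f w) (f z)), fun b => ?_, fun b c hbc => ?_⟩
  · by_cases hb : b = w
    · subst hb
      rw [Function.update_self]
      have h3 := Finset.card_sdiff_add_card_inter (f b) (f z)
      have h4 := Finset.card_sdiff_add_card_inter (f z) (f b)
      rw [Finset.inter_comm (f z)] at h4
      have : symmDiff (f b) (f z) = f b \ f z ∪ f z \ f b := rfl
      rw [this, Finset.card_union_of_disjoint disjoint_sdiff_sdiff]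
      rw [hf] at h3 h4; omega
    · rw [Function.update_of_ne hb, hf]
  · by_cases hb : b = w
    · subst hb
      rw [Function.update_self, Function.update_of_ne hbc.symm, loser c hbc.symm]
    · rw [Function.update_of_ne hb]
      by_cases hcw : c = w
      · subst hcw
        rw [Function.update_self, hY, loser b hb, Finset.inter_comm]
      · rw [Function.update_of_ne hcw, h.off b c hb hcw, hc b c hbc]

/-- Being represented by a line graph is an invariant of the extended Rauzy class. -/
theorem isLineGraph_iff_of_mem_extendedRauzyClass {A : Type*} [Fintype A]
    (hn : 2 ≤ Fintype.card A) (p q : IrrPair A) (h : q ∈ IrrPair.extendedRauzyClass p) :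
    IsLineGraph (Cross (p.1.pos 0) (p.1.pos 1)) ↔ IsLineGraph (Cross (q.1.pos 0) (q.1.pos 1)) := by
  rw [← eq_iff_iff]
  refine eq_of_mem_extendedRauzyClass hn (fun r s => IsLineGraph (Cross r s)) ?_ ?_ ?_ p q h
  · intro r s _ _
    rw [show Cross r s = Cross s r by ext; exact cross_swap]
  · intro r s hr hs
    simp only [show Cross (reflect _ r) (reflect _ s) = Cross r s by ext; exact cross_reflect hr hs]
  · intro r s s' hr hs _ hne hm
    obtain ⟨w, z, hsl⟩ := hm.slide hr hs hne (by omega)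
    exact propext ⟨hsl.isLineGraph (fun _ _ => cross_comm),
      hsl.symm.isLineGraph (fun _ _ => cross_comm)⟩

/-! ### Second invariant: the Gauss sum of the quadratic form. -/

section GaussSum

variable {A : Type*} {n : ℕ} {r s r' s' : A → ℕ}

/-- `-1` on inversions, `1` otherwise. -/
def inversionSign (r s : A → ℕ) (b c : A) : ℤ := if r b < r c ∧ s c < s b then -1 else 1

/-- `-1` on crossing letters, `1` otherwise. -/
def crossSign (r s : A → ℕ) (b c : A) : ℤ := inversionSign r s b c * inversionSign r s c b

theorem crossSign_of_cross {b c : A} (h : Cross r s b c) : crossSign r s b c = -1 := by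
  unfold crossSign inversionSign
  unfold Cross at h
  split_ifs <;> first | rfl | omega

theorem crossSign_of_not_cross {b c : A} (h : ¬Cross r s b c) : crossSign r s b c = 1 := by
  unfold crossSign inversionSign
  unfold Cross at h
  split_ifs <;> first | rfl | omega

theorem crossSign_congr {b c : A} (h : Cross r s b c ↔ Cross r' s' b c) :
    crossSign r s b c = crossSign r' s' b c := by
  by_cases hc : Cross r s b c
  · rw [crossSign_of_cross hc, crossSign_of_cross (h.1 hc)]
  · rw [crossSign_of_not_cross hc, crossSign_of_not_cross (mt h.2 hc)]

theorem crossSign_mul_self (b c : A) : crossSign r s b c * crossSign r s b c = 1 := by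
  by_cases h : Cross r s b c
  · rw [crossSign_of_cross h]; rfl
  · rw [crossSign_of_not_cross h]; rfl

/-- The weighted sum over all sets `T` of letters of `B` of the parity of the number of crossings
in `T`. -/
def gaussSum (r s : A → ℕ) (B : Finset A) (h : A → ℤ) : ℤ :=
  ∑ T ∈ B.powerset, (∏ t ∈ T, h t) * ∏ b ∈ T, ∏ c ∈ T, inversionSign r s b c

@[simp] theorem gaussSum_empty (h : A → ℤ) : gaussSum r s ∅ h = 1 := by simp [gaussSum]

/-- Sets are split by whether they contain `b`; the crossings of `b` are absorbed into the weights.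
General weights make this recursion possible. -/
theorem gaussSum_insert [DecidableEq A] {b : A} {B : Finset A} (hb : b ∉ B) (h : A → ℤ) :
    gaussSum r s (insert b B) h =
      gaussSum r s B h + h b * gaussSum r s B (fun c => h c * crossSign r s b c) := by
  unfold gaussSum
  rw [Finset.sum_powerset_insert hb, Finset.mul_sum]
  congr 1
  refine Finset.sum_congr rfl fun T hT => ?_
  have hbT : b ∉ T := fun h => hb (Finset.mem_powerset.1 hT h)
  have hbb : inversionSign r s b b = 1 := by simp [inversionSign]
  simp only [Finset.prod_insert hbT, Finset.prod_mul_distrib, crossSign, hbb]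
  ring

theorem gaussSum_congr {B : Finset A}
    (hc : ∀ b ∈ B, ∀ c ∈ B, (Cross r s b c ↔ Cross r' s' b c)) {h h' : A → ℤ}
    (hh : ∀ b ∈ B, h b = h' b) : gaussSum r s B h = gaussSum r' s' B h' := by
  classical
  induction B using Finset.induction_on generalizing h h' with
  | empty => simp
  | insert b B hb ih =>
    have hc' : ∀ x ∈ B, ∀ y ∈ B, (Cross r s x y ↔ Cross r' s' x y) := fun x hx y hy =>
      hc x (Finset.mem_insert_of_mem hx) y (Finset.mem_insert_of_mem hy)
    rw [gaussSum_insert hb, gaussSum_insert hb, hh b (Finset.mem_insert_self _ _),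
      ih hc' fun x hx => hh x (Finset.mem_insert_of_mem hx)]
    congr 2
    refine ih hc' fun x hx => ?_
    rw [hh x (Finset.mem_insert_of_mem hx), crossSign_congr
      (hc b (Finset.mem_insert_self _ _) x (Finset.mem_insert_of_mem hx))]

theorem gaussSum_union [DecidableEq A] {B C : Finset A} (hd : Disjoint B C)
    (hc : ∀ b ∈ B, ∀ c ∈ C, ¬Cross r s b c) (h : A → ℤ) :
    gaussSum r s (B ∪ C) h = gaussSum r s B h * gaussSum r s C h := by
  induction B using Finset.induction_on generalizing h with
  | empty => simp
  | insert b B hb ih =>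
    rw [Finset.disjoint_insert_left] at hd
    have hc' : ∀ x ∈ B, ∀ y ∈ C, ¬Cross r s x y := fun x hx =>
      hc x (Finset.mem_insert_of_mem hx)
    rw [Finset.insert_union, gaussSum_insert (by simp [hb, hd.1]), gaussSum_insert hb,
      ih hd.2 hc', ih hd.2 hc']
    rw [gaussSum_congr (r := r) (s := s) (B := C) (h := fun c => h c * crossSign r s b c) (h' := h)
      (fun _ _ _ _ => Iff.rfl) fun c hcC => by
        rw [crossSign_of_not_cross (hc b (Finset.mem_insert_self _ _) c hcC), mul_one]]
    ring

/-- The value of `gaussSum` on `k` pairwise crossing letters of weight `e`. -/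
def cliqueSum : ℕ → ℤ → ℤ
  | 0, _ => 1
  | k + 1, e => cliqueSum k e + e * cliqueSum k (-e)

theorem gaussSum_clique {K : Finset A} (hK : ∀ b ∈ K, ∀ c ∈ K, b ≠ c → Cross r s b c) (e : ℤ) :
    gaussSum r s K (fun _ => e) = cliqueSum K.card e := by
  classical
  induction K using Finset.induction_on generalizing e with
  | empty => simp [cliqueSum]
  | insert b B hb ih =>
    have hK' : ∀ x ∈ B, ∀ y ∈ B, x ≠ y → Cross r s x y := fun x hx y hy =>
      hK x (Finset.mem_insert_of_mem hx) y (Finset.mem_insert_of_mem hy)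
    rw [gaussSum_insert hb, Finset.card_insert_of_notMem hb, cliqueSum, ← ih hK', ← ih hK']
    congr 2
    refine gaussSum_congr (fun _ _ _ _ => Iff.rfl) fun c hc => ?_
    rw [crossSign_of_cross (hK b (Finset.mem_insert_self _ _) c (Finset.mem_insert_of_mem hc)
      fun e => hb (e ▸ hc)), mul_neg_one]

/-- Expanding in `w` and `z` leaves four sums over the remaining letters, with weights -1, -χ_z,
-χ_w and -χ_w χ_z, where χ is `crossSign`. The slide replaces χ_w by χ_w χ_z and so exchanges the
last two. These carry the same sign because `w` and `z` cross. -/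
theorem gaussSum_slide [Fintype A] {w z : A} (hsl : Slide (Cross r s) (Cross r' s') w z) :
    gaussSum r s Finset.univ (fun _ => -1) = gaussSum r' s' Finset.univ (fun _ => -1) := by
  classical
  set B : Finset A := (Finset.univ.erase w).erase z with hB
  have hzB : z ∉ B := by simp [hB]
  have hwB : w ∉ insert z B := by simp [hB, hsl.ne]
  have hu : Finset.univ = insert w (insert z B) := by
    ext x; simp only [hB, Finset.mem_univ, Finset.mem_insert, Finset.mem_erase, true_iff]; tauto
  have hmem : ∀ b ∈ B, b ≠ w ∧ b ≠ z := fun b hb => by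
    simp only [hB, Finset.mem_erase] at hb; exact ⟨hb.2.1, hb.1⟩
  have hBc : ∀ b ∈ B, ∀ c ∈ B, (Cross r s b c ↔ Cross r' s' b c) := fun b hb c hc =>
    (hsl.off b c (hmem b hb).1 (hmem c hc).1).symm
  have hz : ∀ b ∈ B, crossSign r s z b = crossSign r' s' z b := fun b hb =>
    crossSign_congr (hsl.off z b hsl.ne.symm (hmem b hb).1).symm
  have hw : ∀ b ∈ B, crossSign r' s' w b = crossSign r s w b * crossSign r s z b := by
    intro b hb
    have h1 := hsl.loser b (hmem b hb).1 (hmem b hb).2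
    by_cases h2 : Cross r s w b <;> by_cases h3 : Cross r s z b <;>
      simp only [h2, h3, iff_true, iff_false, not_true_eq_false, not_false_eq_true] at h1 <;>
      simp [h1, h2, h3, crossSign_of_cross, crossSign_of_not_cross]
  rw [hu]
  simp only [gaussSum_insert hwB, gaussSum_insert hzB, crossSign_of_cross hsl.cross,
    crossSign_of_cross hsl.cross']
  have e1 := gaussSum_congr (h := fun _ => -1) (h' := fun _ => -1) hBc fun _ _ => rfl
  have e2 := gaussSum_congr (h := fun c => -1 * crossSign r s z c)
    (h' := fun c => -1 * crossSign r' s' z c) hBc fun b hb => by rw [hz b hb]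
  have e3 := gaussSum_congr (h := fun c => -1 * crossSign r s w c)
    (h' := fun c => -1 * crossSign r' s' w c * crossSign r' s' z c) hBc fun b hb => by
      rw [hw b hb, ← hz b hb]
      linear_combination (crossSign r s w b) * crossSign_mul_self (r := r) (s := s) z b
  have e4 := gaussSum_congr (h := fun c => -1 * crossSign r s w c * crossSign r s z c)
    (h' := fun c => -1 * crossSign r' s' w c) hBc fun b hb => by rw [hw b hb]; ring
  rw [e1, e2, e3, e4]
  ring

/-- The Gauss sum of all letters is an invariant of the extended Rauzy class. -/
theorem gaussSum_eq_of_mem_extendedRauzyClass {A : Type*} [Fintype A]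
    (hn : 2 ≤ Fintype.card A) (p q : IrrPair A) (h : q ∈ IrrPair.extendedRauzyClass p) :
    gaussSum (p.1.pos 0) (p.1.pos 1) Finset.univ (fun _ => -1) =
      gaussSum (q.1.pos 0) (q.1.pos 1) Finset.univ (fun _ => -1) := by
  refine eq_of_mem_extendedRauzyClass hn
    (fun r s => gaussSum r s Finset.univ (fun _ => -1)) ?_ ?_ ?_ p q h
  · exact fun r s _ _ => gaussSum_congr (fun _ _ _ _ => cross_swap.symm) fun _ _ => rfl
  · exact fun r s hr hs => gaussSum_congr (fun _ _ _ _ => cross_reflect hr hs) fun _ _ => rfl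
  · intro r s s' hr hs _ hne hm
    obtain ⟨w, z, hsl⟩ := hm.slide hr hs hne (by omega)
    exact gaussSum_slide hsl

end GaussSum

/-! ### Third invariant: the number of marked points. -/

section MarkedPoints

variable {A : Type*} {n : ℕ} {r s s' : A → ℕ}

/-- A partial injection has domain and range of equal size. A marked point is recorded by one of
several letters around it, and exchanging or reflecting the rows changes which one. -/
theorem ncard_exists_right_eq_ncard_exists_left {A : Type*} (R : A → A → Prop)
    (h1 : ∀ b c c', R b c → R b c' → c = c') (h2 : ∀ b b' c, R b c → R b' c → b = b') :
    {b | ∃ c, R b c}.ncard = {c | ∃ b, R b c}.ncard := by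
  refine Set.ncard_congr (fun b hb => Classical.choose hb) ?_ ?_ ?_
  · exact fun b hb => ⟨b, Classical.choose_spec hb⟩
  · intro b b' hb hb' e
    refine h2 b b' _ (Classical.choose_spec hb) ?_
    have := Classical.choose_spec hb'
    exact e ▸ this
  · rintro c ⟨b, hb⟩
    exact ⟨b, ⟨c, hb⟩, h1 b _ _ (Classical.choose_spec ⟨c, hb⟩) hb⟩

/-- The letters `c` that follow the same letter in both rows. -/
def innerPoints (r s : A → ℕ) : Set A := {c | ∃ b, r c = r b + 1 ∧ s c = s b + 1}

/-- The letters `c` that follow in each row the last letter of the other row. -/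
def rightPoints (n : ℕ) (r s : A → ℕ) : Set A :=
  {c | ∃ b z, s b = n ∧ r z = n ∧ r c = r b + 1 ∧ s c = s z + 1}

/-- The letters `c` that precede in each row the first letter of the other row. -/
def leftPoints (r s : A → ℕ) : Set A :=
  {c | ∃ x y, s x = 1 ∧ r y = 1 ∧ r x = r c + 1 ∧ s y = s c + 1}

/-- The last letter of `s`, provided that in each row the last letter of the other row precedes
the first letter of the other row. -/
def outerPoints (n : ℕ) (r s : A → ℕ) : Set A :=
  {b | ∃ z x y, s b = n ∧ r z = n ∧ s x = 1 ∧ r y = 1 ∧ r x = r b + 1 ∧ s y = s z + 1}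

/-- The number of points of total angle `2π` among the endpoints of the letters. -/
noncomputable def markedPoints (n : ℕ) (r s : A → ℕ) : ℕ :=
  (innerPoints r s).ncard + (rightPoints n r s).ncard + (leftPoints r s).ncard +
    (outerPoints n r s).ncard

theorem markedPoints_swap (hr : IsRow n r) (hs : IsRow n s) :
    markedPoints n r s = markedPoints n s r := by
  have h1 : innerPoints r s = innerPoints s r := by
    ext c; simp only [innerPoints, Set.mem_ofPred_eq, and_comm]
  have h2 : rightPoints n r s = rightPoints n s r := by
    ext c
    constructor <;> rintro ⟨b, z, h1, h2, h3, h4⟩ <;> exact ⟨z, b, h2, h1, h4, h3⟩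
  have h3 : leftPoints r s = leftPoints s r := by
    ext c
    constructor <;> rintro ⟨b, z, h1, h2, h3, h4⟩ <;> exact ⟨z, b, h2, h1, h4, h3⟩
  have h4 : (outerPoints n r s).ncard = (outerPoints n s r).ncard := by
    have := ncard_exists_right_eq_ncard_exists_left (fun b z : A => ∃ x y,
      s b = n ∧ r z = n ∧ s x = 1 ∧ r y = 1 ∧ r x = r b + 1 ∧ s y = s z + 1)
      (fun b c c' ⟨_, _, h⟩ ⟨_, _, h'⟩ => hr.inj (h.2.1.trans h'.2.1.symm))
      (fun b b' c ⟨_, _, h⟩ ⟨_, _, h'⟩ => hs.inj (h.1.trans h'.1.symm))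
    unfold outerPoints
    rw [this]
    congr 1
    ext c
    constructor
    · rintro ⟨b, x, y, h1, h2, h3, h4, h5, h6⟩; exact ⟨b, y, x, h2, h1, h4, h3, h6, h5⟩
    · rintro ⟨b, x, y, h1, h2, h3, h4, h5, h6⟩; exact ⟨b, y, x, h2, h1, h4, h3, h6, h5⟩
  unfold markedPoints
  rw [h1, h2, h3, h4]

theorem reflect_eq_one_iff (hr : IsRow n r) {b : A} : reflect n r b = 1 ↔ r b = n := by
  have := hr.one_le b; have := hr.le b
  unfold reflect; omega

theorem reflect_eq_iff (hr : IsRow n r) {b : A} : reflect n r b = n ↔ r b = 1 := by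
  have := hr.one_le b; have := hr.le b
  unfold reflect; omega

theorem reflect_eq_add_one_iff (hr : IsRow n r) {b c : A} :
    reflect n r b = reflect n r c + 1 ↔ r c = r b + 1 := by
  have := hr.one_le b; have := hr.le b; have := hr.one_le c; have := hr.le c
  unfold reflect; omega

theorem markedPoints_reflect (hr : IsRow n r) (hs : IsRow n s) :
    markedPoints n (reflect n r) (reflect n s) = markedPoints n r s := by
  have h1 : (innerPoints (reflect n r) (reflect n s)).ncard = (innerPoints r s).ncard := by
    simp only [innerPoints, reflect_eq_add_one_iff, hr, hs]
    exact ncard_exists_right_eq_ncard_exists_left (fun b c => r c = r b + 1 ∧ s c = s b + 1)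
      (fun b c c' h h' => hr.inj (h.1.trans h'.1.symm))
      (fun b b' c h h' => hr.inj (by omega))
  have h2 : rightPoints n (reflect n r) (reflect n s) = leftPoints r s := by
    simp only [rightPoints, leftPoints, reflect_eq_add_one_iff, reflect_eq_iff, hr, hs]
  have h3 : leftPoints (reflect n r) (reflect n s) = rightPoints n r s := by
    simp only [rightPoints, leftPoints, reflect_eq_add_one_iff, reflect_eq_one_iff, hr, hs]
  have h4 : (outerPoints n (reflect n r) (reflect n s)).ncard = (outerPoints n r s).ncard := by
    simp only [outerPoints, reflect_eq_add_one_iff, reflect_eq_iff, reflect_eq_one_iff, hr, hs]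
    have := ncard_exists_right_eq_ncard_exists_left (fun b x : A => ∃ z y,
      s b = n ∧ r z = n ∧ s x = 1 ∧ r y = 1 ∧ r x = r b + 1 ∧ s y = s z + 1)
      (fun b c c' ⟨_, _, h⟩ ⟨_, _, h'⟩ => hs.inj (by omega))
      (fun b b' c ⟨_, _, h⟩ ⟨_, _, h'⟩ => hs.inj (by omega))
    calc _ = {x | ∃ b z y, s b = n ∧ r z = n ∧ s x = 1 ∧ r y = 1 ∧ r x = r b + 1 ∧
              s y = s z + 1}.ncard := by
          congr 1; ext c
          constructor
          · rintro ⟨z, x, y, h1, h2, h3, h4, h5, h6⟩; exact ⟨x, y, z, h3, h4, h1, h2, h5, h6⟩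
          · rintro ⟨x, y, z, h3, h4, h1, h2, h5, h6⟩; exact ⟨z, x, y, h1, h2, h3, h4, h5, h6⟩
      _ = _ := by
          rw [← this]
          congr 1; ext c
          constructor
          · rintro ⟨x, z, y, h⟩; exact ⟨z, x, y, h⟩
          · rintro ⟨x, z, y, h⟩; exact ⟨z, x, y, h⟩
  unfold markedPoints
  rw [h1, h2, h3, h4]; omega

/-- In the row `s`, with its last letter joined to the last letter of `r`, the letter `d`
follows `b`. -/
def Follows (n : ℕ) (r s : A → ℕ) (b d : A) : Prop :=
  s d = s b + 1 ∨ s b = n ∧ ∃ z, r z = n ∧ s d = s z + 1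

/-- Inner and right points merge into one condition through `Follows`, and so do left and outer
points. In this form the effect of a right move is visible. -/
theorem markedPoints_eq [Finite A] (hr : IsRow n r) (hs : IsRow n s) :
    markedPoints n r s = {c | ∃ b, r c = r b + 1 ∧ Follows n r s b c}.ncard +
      {b | ∃ x y, s x = 1 ∧ r y = 1 ∧ r x = r b + 1 ∧ Follows n r s b y}.ncard := by
  have d1 : Disjoint (innerPoints r s) (rightPoints n r s) := by
    rw [Set.disjoint_left]
    rintro c ⟨b, h1, h2⟩ ⟨b', z, h3, h4, h5, h6⟩
    have : b = b' := hr.inj (by omega)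
    subst this
    have := hs.le c; omega
  have d2 : Disjoint (leftPoints r s) (outerPoints n r s) := by
    rw [Set.disjoint_left]
    rintro c ⟨x, y, h1, h2, h3, h4⟩ ⟨z, x', y', h5, -⟩
    have := hs.le y; omega
  unfold markedPoints
  rw [add_assoc, ← Set.ncard_union_eq d1, ← Set.ncard_union_eq d2]
  congr 2
  · ext c
    simp only [innerPoints, rightPoints, Follows, Set.mem_union, Set.mem_ofPred_eq]
    constructor
    · rintro (⟨b, h1, h2⟩ | ⟨b, z, h1, h2, h3, h4⟩)
      · exact ⟨b, h1, Or.inl h2⟩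
      · exact ⟨b, h3, Or.inr ⟨h1, z, h2, h4⟩⟩
    · rintro ⟨b, h1, h2 | ⟨h2, z, h3, h4⟩⟩
      · exact Or.inl ⟨b, h1, h2⟩
      · exact Or.inr ⟨b, z, h2, h3, h1, h4⟩
  · ext c
    simp only [leftPoints, outerPoints, Follows, Set.mem_union, Set.mem_ofPred_eq]
    constructor
    · rintro (⟨x, y, h1, h2, h3, h4⟩ | ⟨z, x, y, h1, h2, h3, h4, h5, h6⟩)
      · exact ⟨x, y, h1, h2, h3, Or.inl h4⟩
      · exact ⟨x, y, h3, h4, h5, Or.inr ⟨h1, z, h2, h6⟩⟩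
    · rintro ⟨x, y, h1, h2, h3, h4 | ⟨h4, z, h5, h6⟩⟩
      · exact Or.inl ⟨x, y, h1, h2, h3, h4⟩
      · exact Or.inr ⟨z, x, y, h4, h5, h1, h2, h3, h6⟩

/-- Joining the end of `s` to the place after `z` makes the letters right of `z` a cycle. Moving the
last letter to just after `z` only changes where this cycle is cut. -/
theorem RightMove.markedPoints_eq [Finite A] (hn : 1 ≤ n) (hr : IsRow n r) (hs : IsRow n s)
    (hs' : IsRow n s') (hne : ∀ z, ¬(r z = n ∧ s z = n)) (h : RightMove n r s s') :
    markedPoints n r s = markedPoints n r s' := by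
  obtain ⟨z, hz⟩ := hr.exists_eq hn le_rfl
  have hzn : s z < n := lt_of_le_of_ne (hs.le z) fun e => hne z ⟨hz, e⟩
  have hb := h z hz
  have hz1 := hs.one_le z
  have hsz : s' z = s z := by rw [hb, if_pos le_rfl]
  have uniq : ∀ t : A → ℕ, ∀ d, (∃ z, r z = n ∧ t d = t z + 1) ↔ t d = t z + 1 := by
    intro t d
    constructor
    · rintro ⟨y, hy, e⟩
      rwa [hr.inj (hy.trans hz.symm)] at e
    · exact fun e => ⟨z, hz, e⟩
  have first : ∀ x, s x = 1 ↔ s' x = 1 := by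
    intro x
    have := hb x
    split_ifs at this <;> omega
  have fol : ∀ b c d, r c = r b + 1 → (Follows n r s b d ↔ Follows n r s' b d) := by
    intro b c d hbc
    -- `z` is the only letter whose follower the move can change; it has no successor in `r`.
    have hbz : s b ≠ s z := by
      intro e
      have := hs.inj e
      subst this
      have := hr.le c; omega
    have h1 := hb b; have h2 := hb d
    have := hs.le b; have := hs.le d
    unfold Follows
    rw [uniq, uniq, hsz]
    split_ifs at h1 h2 <;> omega
  rw [RPair.markedPoints_eq hr hs, RPair.markedPoints_eq hr hs']
  congr 2
  · ext c
    exact exists_congr fun b => and_congr_right fun h => fol b c c h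
  · ext b
    refine exists_congr fun x => exists_congr fun y => ?_
    rw [first]
    exact and_congr_right fun _ => and_congr_right fun _ => and_congr_right fun h => fol b x y h

/-- The number of marked points is an invariant of the extended Rauzy class. -/
theorem markedPoints_eq_of_mem_extendedRauzyClass {A : Type*} [Fintype A]
    (hn : 2 ≤ Fintype.card A) (p q : IrrPair A) (h : q ∈ IrrPair.extendedRauzyClass p) :
    markedPoints (Fintype.card A) (p.1.pos 0) (p.1.pos 1) =
      markedPoints (Fintype.card A) (q.1.pos 0) (q.1.pos 1) :=
  eq_of_mem_extendedRauzyClass hn (markedPoints (Fintype.card A))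
    (fun _ _ hr hs => markedPoints_swap hr hs) (fun _ _ hr hs => markedPoints_reflect hr hs)
    (fun _ _ _ hr hs hs' hne hm => hm.markedPoints_eq (by omega) hr hs hs' hne) p q h

end MarkedPoints

/-! ### Chains, block sizes and the product over the blocks. -/

section Lists

theorem chains_one_cons (L : List ℕ) : chains (1 :: L) = [] :: chains L := by
  simp [chains, List.splitOn_cons_eq_if_modifyHead]

theorem chains_cons {m : ℕ} (hm : m ≠ 1) (L : List ℕ) :
    chains (m :: L) = (chains L).modifyHead (m :: ·) := by
  simp [chains, List.splitOn_cons_eq_if_modifyHead, hm]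

theorem exists_chains_eq_cons (L : List ℕ) : ∃ C X, chains L = C :: X ∧
    (C = [] ↔ ∀ m ∈ L.head?, m = 1) := by
  cases L with
  | nil => exact ⟨[], [], by simp [chains], by simp⟩
  | cons m L =>
    by_cases hm : m = 1
    · subst hm
      exact ⟨[], chains L, chains_one_cons L, by simp⟩
    · obtain ⟨C, X, h⟩ : ∃ C X, chains L = C :: X :=
        List.exists_cons_of_ne_nil (List.splitOn_ne_nil 1 L)
      exact ⟨m :: C, X, by rw [chains_cons hm, h]; rfl, by simp [hm]⟩

theorem flatten_chains (L : List ℕ) : (chains L).flatten = L.filter (· ≠ 1) := by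
  induction L with
  | nil => simp [chains]
  | cons m L ih =>
    by_cases hm : m = 1
    · subst hm; rw [chains_one_cons]; simpa using ih
    · obtain ⟨C, X, h, -⟩ := exists_chains_eq_cons L
      rw [chains_cons hm, h]
      rw [h] at ih
      rw [List.filter_cons_of_pos (by simpa using hm), ← ih]
      simp

theorem length_chains (L : List ℕ) : (chains L).length = L.count 1 + 1 := by
  induction L with
  | nil => simp [chains]
  | cons m L ih =>
    by_cases hm : m = 1
    · subst hm; rw [chains_one_cons]; simp [ih]
    · rw [chains_cons hm, List.length_modifyHead, ih, List.count_cons_of_ne (by simpa using hm)]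

theorem length_le_length_flatten_add_count_nil (X : List (List ℕ)) :
    X.length ≤ X.flatten.length + X.count [] := by
  induction X with
  | nil => simp
  | cons C X ih =>
    cases C with
    | nil => simp at ih ⊢; omega
    | cons c C => simp at ih ⊢; omega

theorem length_eq_length_flatten_add_count_nil {X : List (List ℕ)}
    (h : ∀ C ∈ X, C ≠ [] → C.length = 1) :
    X.length = X.flatten.length + X.count [] := by
  induction X with
  | nil => simp
  | cons C X ih =>
    have ih := ih fun D hD => h D (List.mem_cons_of_mem _ hD)
    cases C with
    | nil => simp at ih ⊢; omega
    | cons c C =>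
      have := h (c :: C) List.mem_cons_self (by simp)
      simp at ih this ⊢; simp [this]; omega

theorem length_flatten_le_length_filter {X : List (List ℕ)}
    (h : ∀ C ∈ X, C ≠ [] → C.length = 1) :
    X.flatten.length ≤ (X.filter (fun C => C ≠ [])).length := by
  induction X with
  | nil => simp
  | cons C X ih =>
    have ih := ih fun D hD => h D (List.mem_cons_of_mem _ hD)
    cases C with
    | nil => simpa using ih
    | cons c C =>
      have := h (c :: C) List.mem_cons_self (by simp)
      simp at ih this ⊢; simp [this]; omega

theorem eq_two_of_mem_flatten {X : List (List ℕ)} (h : ∀ C ∈ X, C ≠ [] → TwoChain C) :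
    ∀ m ∈ X.flatten, m = 2 := by
  intro m hm
  obtain ⟨C, hC, hmC⟩ := List.mem_flatten.1 hm
  exact h C hC (List.ne_nil_of_mem hmC) m hmC

theorem mem_of_mem_chains {L C : List ℕ} {m : ℕ} (hC : C ∈ chains L) (hm : m ∈ C) : m ∈ L :=
  List.mem_of_mem_filter (flatten_chains L ▸ List.mem_flatten.2 ⟨C, hC, hm⟩)

/-- If the chains consist of `2`-blocks and of one further block `m`, the sizes of the blocks are
`m`, `2, …, 2` and `1, …, 1`. -/
theorem exists_perm_of_chains {L P Q : List ℕ} {X Y : List (List ℕ)} {m : ℕ}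
    (hL : chains L = X ++ (P ++ m :: Q) :: Y) (hX : ∀ C ∈ X ++ Y, C ≠ [] → TwoChain C)
    (hP : ∀ b ∈ P, b = 2) (hQ : ∀ b ∈ Q, b = 2) :
    ∃ u, (chains L).flatten.length = u + 1 ∧
      L.Perm (m :: (List.replicate u 2 ++ List.replicate (L.count 1) 1)) := by
  have hX' : ∀ b ∈ X.flatten, b = 2 :=
    eq_two_of_mem_flatten fun C hC => hX C (List.mem_append_left _ hC)
  have hY' : ∀ b ∈ Y.flatten, b = 2 :=
    eq_two_of_mem_flatten fun C hC => hX C (List.mem_append_right _ hC)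
  have h1 : (chains L).flatten.Perm (m :: (X.flatten ++ P ++ (Q ++ Y.flatten))) := by
    rw [hL]
    simp only [List.flatten_append, List.flatten_cons, List.append_assoc, List.cons_append]
    rw [← List.append_assoc, ← List.append_assoc]
    exact List.perm_middle
  have h2 : X.flatten ++ P ++ (Q ++ Y.flatten) =
      List.replicate (X.flatten ++ P ++ (Q ++ Y.flatten)).length 2 := by
    refine List.eq_replicate_iff.2 ⟨rfl, fun b hb => ?_⟩
    simp only [List.mem_append] at hb
    rcases hb with (hb | hb) | hb | hb
    exacts [hX' b hb, hP b hb, hQ b hb, hY' b hb]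
  refine ⟨(X.flatten ++ P ++ (Q ++ Y.flatten)).length, by rw [h1.length_eq, List.length_cons], ?_⟩
  rw [← h2]
  have h3 := List.filter_append_perm (fun b => decide (b ≠ 1)) L
  rw [← flatten_chains] at h3
  have h4 : L.filter (fun x => !decide (x ≠ 1)) = List.replicate (L.count 1) 1 := by
    rw [← List.filter_beq]
    congr 1; ext x; by_cases hx : x = 1 <;> simp [hx]
  rw [h4] at h3
  exact h3.symm.trans (h1.append_right _)

/-- The contribution of the blocks to the Gauss sum. -/
def blockProduct (L : List ℕ) : ℤ := (L.map fun m => cliqueSum m 1).prod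

theorem blockProduct_cons (m : ℕ) (L : List ℕ) :
    blockProduct (m :: L) = cliqueSum m 1 * blockProduct L := by
  simp [blockProduct]

/-- Blocks of size 1 and of size 2 both contribute the factor 2. -/
theorem blockProduct_of_perm {L : List ℕ} {m u v : ℕ}
    (h : L.Perm (m :: (List.replicate u 2 ++ List.replicate v 1))) :
    blockProduct L = cliqueSum m 1 * 2 ^ (u + v) := by
  unfold blockProduct
  rw [(h.map _).prod_eq]
  simp [cliqueSum, pow_add]

theorem blockProduct_pos {L : List ℕ} (h : ∀ C ∈ chains L, C ≠ [] → TwoChain C) :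
    0 < blockProduct L := by
  have h1 := eq_two_of_mem_flatten h
  rw [flatten_chains] at h1
  refine List.prod_pos fun x hx => ?_
  obtain ⟨m, hm, rfl⟩ := List.mem_map.1 hx
  by_cases h2 : m = 1
  · subst h2; decide
  · rw [h1 m (List.mem_filter.2 ⟨hm, by simpa using h2⟩)]; decide

theorem blockProduct_eq_zero {L : List ℕ} (h : 3 ∈ L) : blockProduct L = 0 :=
  List.prod_eq_zero (List.mem_map.2 ⟨3, h, by decide⟩)

/-- The shape of the list of blocks in Type `<4>`. -/
theorem TypeCondition.shape_four {L : List ℕ} (h : TypeCondition 4 L) :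
    ∃ u v, L.Perm (4 :: (List.replicate u 2 ++ List.replicate v 1)) ∧
      v ≤ (chains L).count [] + u := by
  obtain ⟨-, X, Y, C, hL, ⟨k, rfl⟩, hD⟩ := h
  obtain ⟨u, hu, hp⟩ := exists_perm_of_chains (P := []) hL hD (by simp)
    (fun b hb => List.eq_of_mem_replicate hb)
  refine ⟨u, _, hp, ?_⟩
  -- There are `v + 1` chains and `u + 1` blocks in them; each non-empty chain uses at least one
  -- block.
  have h1 := length_le_length_flatten_add_count_nil (chains L)
  rw [length_chains, hu] at h1
  omega

/-- The shape of the list of blocks in Type `<5>`. -/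
theorem TypeCondition.shape_five {L : List ℕ} (h : TypeCondition 5 L) :
    ∃ u v, L.Perm (5 :: (List.replicate u 2 ++ List.replicate v 1)) ∧
      v = (chains L).count [] + u := by
  obtain ⟨-, X, Y, hL, hD⟩ := h
  obtain ⟨u, hu, hp⟩ := exists_perm_of_chains (P := []) (Q := []) hL
    (fun D h1 h2 b hb => by rw [hD D h1 h2] at hb; simpa using hb) (by simp) (by simp)
  refine ⟨u, _, hp, ?_⟩
  -- Here every non-empty chain is a single block, so the count is an equality.
  have h1 := length_eq_length_flatten_add_count_nil (X := chains L) fun D h1 h2 => by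
    rw [hL] at h1
    simp only [List.mem_append, List.mem_cons] at h1
    rcases h1 with h1 | rfl | h1
    · rw [hD D (List.mem_append_left _ h1) h2]; rfl
    · rfl
    · rw [hD D (List.mem_append_right _ h1) h2]; rfl
  rw [length_chains, hu] at h1
  omega

theorem TypeCondition.count_le_one {L : List ℕ} (h : TypeCondition 1 L) :
    (L.filter (· ≠ 1)).length ≤ 1 := by
  rw [← flatten_chains]
  exact (length_flatten_le_length_filter h.2).trans h.1

theorem TypeCondition.manyBlocks {L : List ℕ} {x : ℕ} (h : TypeCondition x L) (hx : x ≠ 1) :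
    ManyBlocks L := by
  match x, h with
  | 2, h => exact h.1
  | 3, h => exact h.1
  | 4, h => exact h.1
  | 5, h => exact h.1

/-- Types `<4>` and `<5>` are separated by the number of letters, the Gauss sum and the number of
empty chains. -/
theorem not_typeCondition_four_and_five {L L' : List ℕ} (h : TypeCondition 4 L)
    (h' : TypeCondition 5 L') (hs : L.sum = L'.sum) (hp : blockProduct L = blockProduct L')
    (hc : (chains L).count [] = (chains L').count []) : False := by
  obtain ⟨u, v, h1, h2⟩ := h.shape_four
  obtain ⟨u', v', h1', h2'⟩ := h'.shape_five
  rw [blockProduct_of_perm h1, blockProduct_of_perm h1',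
    show cliqueSum 4 1 = -4 by decide, show cliqueSum 5 1 = -8 by decide] at hp
  have h3 : (2 : ℤ) ^ (u + v) = 2 ^ (u' + v' + 1) := by rw [pow_succ]; linarith
  have h4 := pow_right_injective₀ (a := (2 : ℤ)) (by norm_num) (by norm_num) h3
  rw [h1.sum_eq, h1'.sum_eq] at hs
  simp at hs
  -- The Gauss sums give u + v = u' + v' + 1 and the letters give 2u + v = 2u' + v' + 1, so u = u'
  -- and v = v' + 1. With e empty chains on both sides, v' = e + u' contradicts v ≤ e + u.
  omega

end Lists

/-! ### Block pairs and their Gauss sum. -/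

section Blocks

variable {A : Type*} {n : ℕ} {r s : A → ℕ}

/-- From position `k` on, the rows `r` and `s` consist of order reversing blocks with the sizes
listed in `L`. -/
def ReversesBlocks (r s : A → ℕ) : ℕ → List ℕ → Prop
  | _, [] => True
  | k, m :: L => (∀ b, k ≤ r b → r b < k + m → r b + s b = 2 * k + m - 1) ∧
      ReversesBlocks r s (k + m) L

theorem reversesBlocks_of_forall {L : List ℕ} {k : ℕ}
    (h : ∀ i < L.length, ∀ b, k + (L.take i).sum ≤ r b → r b < k + (L.take (i + 1)).sum →
      r b + s b = (k + (L.take i).sum) + (k + (L.take (i + 1)).sum) - 1) :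
    ReversesBlocks r s k L := by
  induction L generalizing k with
  | nil => trivial
  | cons m L ih =>
    refine ⟨fun b h1 h2 => ?_, ih fun i hi b h1 h2 => ?_⟩
    · have := h 0 (by simp) b (by simpa using h1) (by simpa using h2)
      simp at this; omega
    · have := h (i + 1) (by simpa using hi) b (by simp; omega) (by simp; omega)
      simp at this; omega

theorem ReversesBlocks.mem_range {L : List ℕ} {k : ℕ} (h : ReversesBlocks r s k L) {b : A}
    (h1 : k ≤ r b) (h2 : r b < k + L.sum) : k ≤ s b ∧ s b < k + L.sum := by
  induction L generalizing k with
  | nil => simp at h2; omega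
  | cons m L ih =>
    simp only [List.sum_cons] at h2 ⊢
    by_cases h3 : r b < k + m
    · have := h.1 b h1 h3; omega
    · have := ih h.2 (by omega) (by omega); omega

/-- Two rows of `n` letters that form a standard pair, with order reversing blocks of the sizes
listed in `L` between the outer letters. -/
structure IsBlockPair (n : ℕ) (r s : A → ℕ) (L : List ℕ) : Prop where
  row : IsRow n r
  row' : IsRow n s
  sum : 2 + L.sum = n
  pos : ∀ m ∈ L, 0 < m
  first : ∀ b, r b = 1 ↔ s b = n
  last : ∀ b, s b = 1 ↔ r b = n
  blocks : ReversesBlocks r s 2 L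

theorem IsPiecewiseOrderReversing.isBlockPair {A : Type*} [Fintype A] {p : RPair A} {L : List ℕ}
    (h : p.IsPiecewiseOrderReversing L) :
    IsBlockPair (Fintype.card A) (p.pos 0) (p.pos 1) L where
  row := p.bij 0
  row' := p.bij 1
  sum := by have := h.2.2.1; rwa [breakPoint, List.take_length] at this
  pos := h.2.1
  first := h.1.2.1
  last := h.1.2.2
  blocks := reversesBlocks_of_forall fun i hi => (h.2.2.2 i hi).2

/-- The letters in the positions `k, …, l - 1` of `r`. -/
def lettersIco [Fintype A] (r : A → ℕ) (k l : ℕ) : Finset A :=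
  Finset.univ.filter fun b => k ≤ r b ∧ r b < l

theorem mem_lettersIco [Fintype A] {k l : ℕ} {b : A} :
    b ∈ lettersIco r k l ↔ k ≤ r b ∧ r b < l := by simp [lettersIco]

theorem card_lettersIco [Fintype A] (hr : IsRow n r) {k l : ℕ} (hk : 1 ≤ k) (hl : l ≤ n + 1) :
    (lettersIco r k l).card = l - k := by
  classical
  rw [← Nat.card_Ico, ← Finset.card_image_of_injective (lettersIco r k l)
    (f := r) fun _ _ e => hr.inj e]
  congr 1
  ext j
  simp only [Finset.mem_image, mem_lettersIco, Finset.mem_Ico]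
  constructor
  · rintro ⟨b, hb, rfl⟩; exact hb
  · intro hj
    obtain ⟨b, rfl⟩ := hr.exists_eq (k := j) (by omega) (by omega)
    exact ⟨b, hj, rfl⟩

/-- Letters of one block cross pairwise and letters of different blocks do not cross, so the sum
factors over the blocks. -/
theorem gaussSum_lettersIco [Fintype A] (hr : IsRow n r) {L : List ℕ} {k : ℕ}
    (h : ReversesBlocks r s k L) (hk : 1 ≤ k) (hl : k + L.sum ≤ n + 1) :
    gaussSum r s (lettersIco r k (k + L.sum)) (fun _ => 1) =
      blockProduct L := by
  classical
  induction L generalizing k with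
  | nil =>
    have : lettersIco r k (k + ([] : List ℕ).sum) = ∅ := by
      ext b; simp [mem_lettersIco]
    rw [this]; simp [blockProduct]
  | cons m L ih =>
    simp only [List.sum_cons] at hl
    have hu : lettersIco r k (k + (m :: L).sum) =
        lettersIco r k (k + m) ∪ lettersIco r (k + m) (k + m + L.sum) := by
      ext b; simp only [mem_lettersIco, Finset.mem_union, List.sum_cons]; omega
    rw [hu, gaussSum_union, ih h.2 (by omega) (by omega), gaussSum_clique,
      card_lettersIco hr hk (by omega), blockProduct_cons, Nat.add_sub_cancel_left]
    · intro b hb c hc hbc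
      rw [mem_lettersIco] at hb hc
      have := h.1 b hb.1 hb.2; have := h.1 c hc.1 hc.2
      have : r b ≠ r c := fun e => hbc (hr.inj e)
      unfold Cross; omega
    · rw [Finset.disjoint_left]
      intro b hb hc
      rw [mem_lettersIco] at hb hc; omega
    · intro b hb c hc
      rw [mem_lettersIco] at hb hc
      have := h.1 b hb.1 hb.2
      have := h.2.mem_range hc.1 hc.2
      unfold Cross; omega

namespace IsBlockPair

variable {L : List ℕ}

theorem exists_outer (h : IsBlockPair n r s L) :
    ∃ a z, r a = 1 ∧ s a = n ∧ r z = n ∧ s z = 1 := by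
  have := h.sum
  obtain ⟨a, ha⟩ := h.row.exists_eq (k := 1) le_rfl (by omega)
  obtain ⟨z, hz⟩ := h.row.exists_eq (k := n) (by omega) le_rfl
  exact ⟨a, z, ha, (h.first a).1 ha, hz, (h.last z).2 hz⟩

theorem inner_lt (h : IsBlockPair n r s L) {b : A} (h1 : r b ≠ 1) (h2 : r b ≠ n) :
    2 ≤ r b ∧ r b < n ∧ 2 ≤ s b ∧ s b < n := by
  have h3 := mt (h.first b).2 h1
  have h4 := mt (h.last b).1 h2
  have := h.row.one_le b; have := h.row'.one_le b; have := h.row.le b; have := h.row'.le b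
  omega

/-- The two outer letters cross each other and every inner letter. If G(e) is the sum over the inner
letters with weight e, expanding in them gives G(-1) - G(1) - (G(1) + G(-1)) = -2 G(1). -/
theorem gaussSum_univ [Fintype A] (h : IsBlockPair n r s L) :
    gaussSum r s Finset.univ (fun _ => -1) = -2 * blockProduct L := by
  classical
  obtain ⟨a, z, ra, sa, rz, sz⟩ := h.exists_outer
  have hn := h.sum
  set B := lettersIco r 2 (2 + L.sum) with hB
  have hmem : ∀ b ∈ B, 2 ≤ r b ∧ r b < n ∧ 2 ≤ s b ∧ s b < n := by
    intro b hb
    rw [hB, mem_lettersIco] at hb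
    exact h.inner_lt (by omega) (by omega)
  have haz : a ≠ z := by rintro rfl; omega
  have hzB : z ∉ B := fun hz => by have := hmem z hz; omega
  have haB : a ∉ insert z B := by
    rw [Finset.mem_insert, not_or]
    exact ⟨haz, fun ha => by have := hmem a ha; omega⟩
  have hu : Finset.univ = insert a (insert z B) := by
    ext b
    simp only [Finset.mem_univ, Finset.mem_insert, true_iff]
    by_cases h1 : r b = 1
    · exact Or.inl (h.row.inj (h1.trans ra.symm))
    by_cases h2 : r b = n
    · exact Or.inr (Or.inl (h.row.inj (h2.trans rz.symm)))
    have := h.inner_lt h1 h2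
    exact Or.inr (Or.inr (mem_lettersIco.2 ⟨this.1, by omega⟩))
  have hac : ∀ b ∈ B, crossSign r s a b = -1 := fun b hb => by
    have := hmem b hb; exact crossSign_of_cross (by unfold Cross; omega)
  have hzc : ∀ b ∈ B, crossSign r s z b = -1 := fun b hb => by
    have := hmem b hb; exact crossSign_of_cross (by unfold Cross; omega)
  have hazc : crossSign r s a z = -1 := crossSign_of_cross (by unfold Cross; omega)
  have key := gaussSum_lettersIco h.row h.blocks (by omega) (by omega)
  rw [← hB] at key
  rw [hu]
  simp only [gaussSum_insert haB, gaussSum_insert hzB, hazc]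
  rw [gaussSum_congr (B := B) (h := fun c => -1 * crossSign r s z c) (h' := fun _ => 1)
      (fun _ _ _ _ => Iff.rfl) fun b hb => by rw [hzc b hb]; rfl,
    gaussSum_congr (B := B) (h := fun c => -1 * crossSign r s a c) (h' := fun _ => 1)
      (fun _ _ _ _ => Iff.rfl) fun b hb => by rw [hac b hb]; rfl,
    gaussSum_congr (B := B) (h := fun c => -1 * crossSign r s a c * crossSign r s z c)
      (h' := fun _ => -1) (fun _ _ _ _ => Iff.rfl) fun b hb => by
        rw [hac b hb, hzc b hb]; rfl, key]
  ring

end IsBlockPair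

/-! ### Line graphs: one large block against several. -/

theorem ReversesBlocks.eq_of_forall_eq_one {L : List ℕ} {k : ℕ} (h : ReversesBlocks r s k L)
    (h1 : ∀ m ∈ L, m = 1) {b : A} (hb : k ≤ r b) (hb' : r b < k + L.sum) : s b = r b := by
  induction L generalizing k with
  | nil => simp at hb'; omega
  | cons m L ih =>
    obtain rfl := h1 m List.mem_cons_self
    simp only [List.sum_cons] at hb'
    by_cases h3 : r b < k + 1
    · have := h.1 b hb h3; omega
    · exact ih h.2 (fun x hx => h1 x (List.mem_cons_of_mem _ hx)) (by omega) (by omega)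

/-- If at most one block has a size other than `1`, the rows agree outside one reversed interval. -/
theorem ReversesBlocks.exists_interval {L : List ℕ} {k : ℕ} (h : ReversesBlocks r s k L)
    (hL : (L.filter (· ≠ 1)).length ≤ 1) :
    ∃ lo hi, k ≤ lo ∧ ∀ b, k ≤ r b → r b < k + L.sum →
      (lo ≤ r b ∧ r b < hi ∧ r b + s b = lo + hi - 1) ∨ (¬(lo ≤ r b ∧ r b < hi) ∧ s b = r b) := by
  induction L generalizing k with
  | nil => exact ⟨k, k, le_rfl, fun b h1 h2 => by simp at h2; omega⟩
  | cons m L ih =>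
    simp only [List.sum_cons]
    by_cases hm : m = 1
    · subst hm
      obtain ⟨lo, hi, hlo, H⟩ := ih h.2 (by simpa using hL)
      refine ⟨lo, hi, by omega, fun b h1 h2 => ?_⟩
      by_cases h3 : r b < k + 1
      · have := h.1 b h1 h3; omega
      · exact H b (by omega) (by omega)
    · rw [List.filter_cons_of_pos (by simpa using hm)] at hL
      have h1 : ∀ x ∈ L, x = 1 := by
        intro x hx
        by_contra hne
        have := List.length_pos_of_mem (List.mem_filter.2 ⟨hx, by simpa using hne⟩ :
          x ∈ L.filter (· ≠ 1))
        simp only [List.length_cons] at hL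
        omega
      refine ⟨k, k + m, le_rfl, fun b hb hb' => ?_⟩
      by_cases h3 : r b < k + m
      · have := h.1 b hb h3; omega
      · have := h.2.eq_of_forall_eq_one h1 (b := b) (by omega) (by omega); omega

theorem zero_pair_inter_zero_pair {x y : ℕ} (h : x ≠ y) (hx : x ≠ 0) :
    ({0, x} ∩ {0, y} : Finset ℕ) = {0} := by
  ext t; simp only [Finset.mem_inter, Finset.mem_insert, Finset.mem_singleton]; omega

theorem odd_card_zero_pair_inter {x : ℕ} :
    Odd (({0, x} ∩ {1, 2} : Finset ℕ)).card ↔ x = 1 ∨ x = 2 := by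
  by_cases h1 : x = 1
  · subst h1; decide
  by_cases h2 : x = 2
  · subst h2; decide
  have : ({0, x} ∩ {1, 2} : Finset ℕ) = ∅ := by
    refine Finset.eq_empty_of_forall_notMem fun t => ?_
    simp only [Finset.mem_inter, Finset.mem_insert, Finset.mem_singleton]; omega
  simp [this, h1, h2]

/-- The outer letters and the large block cross pairwise: they form a star at 0, with outer edges
{0, 1} and {0, 2}. Each `1`-block crosses only the outer letters and becomes a parallel copy of {1,
2}; parallel edges share two vertices, hence do not cross. -/
theorem IsBlockPair.isLineGraph {L : List ℕ} (h : IsBlockPair n r s L)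
    (hL : (L.filter (· ≠ 1)).length ≤ 1) : IsLineGraph (Cross r s) := by
  classical
  obtain ⟨lo, hi, hlo, H⟩ := h.blocks.exists_interval hL
  have hn := h.sum
  set P : A → Prop := fun b => r b ≠ 1 ∧ r b ≠ n ∧ ¬(lo ≤ r b ∧ r b < hi) with hP
  set x : A → ℕ := fun b => if r b = 1 then 1 else if r b = n then 2 else r b + 3 with hx
  have x0 : ∀ b, x b ≠ 0 := by
    intro b; simp only [hx]; split_ifs <;> omega
  have xinj : ∀ b c, b ≠ c → x b ≠ x c := by
    intro b c hbc
    have : r b ≠ r c := fun e => hbc (h.row.inj e)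
    simp only [hx]; split_ifs <;> omega
  have facts : ∀ b, (r b = 1 ∧ s b = n) ∨ (r b = n ∧ s b = 1) ∨ (2 ≤ r b ∧ r b < n ∧
      2 ≤ s b ∧ s b < n ∧ ((lo ≤ r b ∧ r b < hi ∧ r b + s b = lo + hi - 1) ∨
        (¬(lo ≤ r b ∧ r b < hi) ∧ s b = r b))) := by
    intro b
    by_cases h1 : r b = 1
    · exact Or.inl ⟨h1, (h.first b).1 h1⟩
    by_cases h2 : r b = n
    · exact Or.inr (Or.inl ⟨h2, (h.last b).2 h2⟩)
    have h3 := h.inner_lt h1 h2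
    exact Or.inr (Or.inr ⟨h3.1, h3.2.1, h3.2.2.1, h3.2.2.2, H b h3.1 (by omega)⟩)
  have mixed : ∀ b c, ¬P b → P c → (Cross r s b c ↔ x b = 1 ∨ x b = 2) := by
    intro b c hb hc
    have h1 := facts b; have h2 := facts c
    simp only [hP] at hb hc
    simp only [hx]
    unfold Cross; split_ifs <;> omega
  refine ⟨fun b => if P b then {1, 2} else {0, x b}, fun b => ?_, fun b c hbc => ?_⟩
  · dsimp only
    split_ifs
    · rfl
    · exact Finset.card_pair (x0 b).symm
  · have hrbc : r b ≠ r c := fun e => hbc (h.row.inj e)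
    have h1 := facts b; have h2 := facts c
    by_cases hb : P b <;> by_cases hc : P c
    · simp only [hb, hc, if_true]
      refine ⟨fun hX => ?_, fun ho => absurd ho (by decide)⟩
      simp only [hP] at hb hc
      unfold Cross at hX; omega
    · simp only [hb, hc, if_true, if_false]
      rw [Finset.inter_comm, odd_card_zero_pair_inter, cross_comm]
      exact mixed c b hc hb
    · simp only [hb, hc, if_true, if_false]
      rw [odd_card_zero_pair_inter]
      exact mixed b c hb hc
    · simp only [hb, hc, if_false]
      rw [zero_pair_inter_zero_pair (xinj b c hbc) (x0 b)]
      simp only [hP] at hb hc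
      refine ⟨fun _ => by decide, fun _ => ?_⟩
      unfold Cross; omega

theorem odd_card_pair_inter {x y : ℕ} (h : x ≠ y) (F : Finset ℕ) :
    Odd (({x, y} : Finset ℕ) ∩ F).card ↔ ¬(x ∈ F ↔ y ∈ F) := by
  by_cases hx : x ∈ F <;> by_cases hy : y ∈ F <;>
    simp [Finset.insert_inter_of_mem, Finset.insert_inter_of_notMem, hx, hy, h]

/-- In a line graph, two adjacent vertices do not have two independent edges of common neighbours. -/
theorem not_isLineGraph {X : A → A → Prop} {a z b c d e : A} (haz : a ≠ z) (hbc : b ≠ c)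
    (hde : d ≠ e) (Xaz : X a z) (Xbc : X b c) (Xde : X d e)
    (ha : ∀ x ∈ ({b, c, d, e} : Set A), a ≠ x ∧ X a x)
    (hz : ∀ x ∈ ({b, c, d, e} : Set A), z ≠ x ∧ X z x)
    (hbd : b ≠ d ∧ ¬X b d) (hcd : c ≠ d ∧ ¬X c d) : ¬IsLineGraph X := by
  rintro ⟨f, hf, H⟩
  have card_inter : ∀ {p q}, p ≠ q → X p q → (f p ∩ f q).card = 1 := by
    intro p q hpq hX
    have h1 := (H p q hpq).1 hX
    have h2 := Finset.card_le_card (Finset.inter_subset_left (s₁ := f p) (s₂ := f q))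
    rw [hf] at h2
    rw [Nat.odd_iff] at h1; omega
  obtain ⟨o, ho⟩ := Finset.card_eq_one.1 (card_inter haz Xaz)
  have hoaz : o ∈ f a ∩ f z := by rw [ho]; exact Finset.mem_singleton_self o
  rw [Finset.mem_inter] at hoaz
  have other : ∀ p, o ∈ f p → ∃ x, o ≠ x ∧ f p = {o, x} := by
    intro p hp
    obtain ⟨x, y, hxy, e⟩ := Finset.card_eq_two.1 (hf p)
    rw [e, Finset.mem_insert, Finset.mem_singleton] at hp
    rcases hp with rfl | rfl
    · exact ⟨y, hxy, e⟩
    · exact ⟨x, hxy.symm, by rw [e, Finset.pair_comm]⟩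
  obtain ⟨x, hox, hfa⟩ := other a hoaz.1
  obtain ⟨y, hoy, hfz⟩ := other z hoaz.2
  have hxy : x ≠ y := by
    rintro rfl
    have := card_inter haz Xaz
    rw [hfa, hfz, Finset.inter_self, Finset.card_pair hox] at this
    omega
  -- With edges {o, x} and {o, y} for `a` and `z`, a common neighbour either contains `o` and avoids
  -- `x`, `y`, or is the edge {x, y}.
  have nb : ∀ p ∈ ({b, c, d, e} : Set A), ¬(o ∈ f p ↔ x ∈ f p) ∧ ¬(o ∈ f p ↔ y ∈ f p) := by
    intro p hp
    have h1 := (H a p (ha p hp).1).1 (ha p hp).2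
    have h2 := (H z p (hz p hp).1).1 (hz p hp).2
    rw [hfa, odd_card_pair_inter hox] at h1
    rw [hfz, odd_card_pair_inter hoy] at h2
    exact ⟨h1, h2⟩
  -- The edge {x, y} meets every common neighbour in an even number of vertices, so a common
  -- neighbour crossing another one contains `o`.
  have mem : ∀ p ∈ ({b, c, d, e} : Set A), ∀ q ∈ ({b, c, d, e} : Set A), p ≠ q → X p q →
      o ∈ f p := by
    intro p hp q hq hpq hX
    by_contra hop
    have h1 := nb p hp
    have h2 := nb q hq
    have h3 : f p = {x, y} := by
      refine (Finset.eq_of_subset_of_card_le ?_ ?_).symm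
      · intro t ht
        rw [Finset.mem_insert, Finset.mem_singleton] at ht
        rcases ht with rfl | rfl <;> tauto
      · rw [hf, Finset.card_pair hxy]
    have h4 := (H p q hpq).1 hX
    rw [h3, odd_card_pair_inter hxy] at h4
    tauto
  have ob : o ∈ f b := mem b (by simp) c (by simp) hbc Xbc
  have oc : o ∈ f c := mem c (by simp) b (by simp) hbc.symm ((H c b hbc.symm).2 (by
    rw [Finset.inter_comm]; exact (H b c hbc).1 Xbc))
  have od : o ∈ f d := mem d (by simp) e (by simp) hde Xde
  -- Two edges through `o` that do not cross coincide. Thus `b` and `c` both have the edge of `d`,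
  -- although they cross.
  have eqd : ∀ p, p ≠ d ∧ ¬X p d → o ∈ f p → f p = f d := by
    intro p hp hop
    have h1 := mt (H p d hp.1).2 hp.2
    obtain ⟨t, hot, e⟩ := other p hop
    rw [e, odd_card_pair_inter hot, not_not] at h1
    rw [e]
    refine Finset.eq_of_subset_of_card_le ?_ ?_
    · intro u hu
      rw [Finset.mem_insert, Finset.mem_singleton] at hu
      rcases hu with rfl | rfl <;> tauto
    · rw [hf, Finset.card_pair hot]
  have := card_inter hbc Xbc
  rw [eqd b hbd ob, eqd c hcd oc, Finset.inter_self, hf] at this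
  omega

theorem ReversesBlocks.exists_large_block {L : List ℕ} {k : ℕ} (h : ReversesBlocks r s k L)
    (hL : 1 ≤ (L.filter (fun m => 2 ≤ m)).length) :
    ∃ lo hi, k ≤ lo ∧ lo + 2 ≤ hi ∧ hi ≤ k + L.sum ∧
      ∀ b, lo ≤ r b → r b < hi → r b + s b = lo + hi - 1 := by
  induction L generalizing k with
  | nil => simp at hL
  | cons m L ih =>
    simp only [List.sum_cons]
    by_cases hm : 2 ≤ m
    · exact ⟨k, k + m, le_rfl, by omega, by omega, fun b h1 h2 => by
        have := h.1 b h1 h2; omega⟩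
    · rw [List.filter_cons_of_neg (by simpa using hm)] at hL
      obtain ⟨lo, hi, h1, h2, h3, h4⟩ := ih h.2 hL
      exact ⟨lo, hi, by omega, h2, by omega, h4⟩

theorem ReversesBlocks.exists_two_large_blocks {L : List ℕ} {k : ℕ} (h : ReversesBlocks r s k L)
    (hL : 2 ≤ (L.filter (fun m => 2 ≤ m)).length) :
    ∃ lo hi lo' hi', k ≤ lo ∧ lo + 2 ≤ hi ∧ hi ≤ lo' ∧ lo' + 2 ≤ hi' ∧ hi' ≤ k + L.sum ∧
      (∀ b, lo ≤ r b → r b < hi → r b + s b = lo + hi - 1) ∧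
      ∀ b, lo' ≤ r b → r b < hi' → r b + s b = lo' + hi' - 1 := by
  induction L generalizing k with
  | nil => simp at hL
  | cons m L ih =>
    simp only [List.sum_cons]
    by_cases hm : 2 ≤ m
    · rw [List.filter_cons_of_pos (by simpa using hm), List.length_cons] at hL
      obtain ⟨lo', hi', h1, h2, h3, h4⟩ := h.2.exists_large_block (by omega)
      exact ⟨k, k + m, lo', hi', le_rfl, by omega, h1, h2, by omega, fun b h1 h2 => by
        have := h.1 b h1 h2; omega, h4⟩
    · rw [List.filter_cons_of_neg (by simpa using hm)] at hL
      obtain ⟨lo, hi, lo', hi', h1, h2, h3, h4, h5, h6⟩ := ih h.2 hL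
      exact ⟨lo, hi, lo', hi', by omega, h2, h3, h4, by omega, h6⟩

theorem IsBlockPair.not_isLineGraph {L : List ℕ} (h : IsBlockPair n r s L) (hL : ManyBlocks L) :
    ¬IsLineGraph (Cross r s) := by
  obtain ⟨a, z, ra, sa, rz, sz⟩ := h.exists_outer
  have hn := h.sum
  obtain ⟨lo, hi, lo', hi', h1, h2, h3, h4, h5, H, H'⟩ := h.blocks.exists_two_large_blocks hL
  obtain ⟨b, rb⟩ := h.row.exists_eq (k := lo) (by omega) (by omega)
  obtain ⟨c, rc⟩ := h.row.exists_eq (k := lo + 1) (by omega) (by omega)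
  obtain ⟨d, rd⟩ := h.row.exists_eq (k := lo') (by omega) (by omega)
  obtain ⟨e, re⟩ := h.row.exists_eq (k := lo' + 1) (by omega) (by omega)
  have sb := H b (by omega) (by omega)
  have sc := H c (by omega) (by omega)
  have sd := H' d (by omega) (by omega)
  have se := H' e (by omega) (by omega)
  have ne : ∀ {p q : A}, r p ≠ r q → p ≠ q := fun h e => h (e ▸ rfl)
  refine RPair.not_isLineGraph (a := a) (z := z) (b := b) (c := c) (d := d) (e := e)
    (ne (by omega)) (ne (by omega)) (ne (by omega)) ?_ ?_ ?_ ?_ ?_ ⟨ne (by omega), ?_⟩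
    ⟨ne (by omega), ?_⟩
  · unfold Cross; omega
  · unfold Cross; omega
  · unfold Cross; omega
  · rintro x (rfl | rfl | rfl | rfl) <;>
      exact ⟨ne (by omega), by unfold Cross; omega⟩
  · rintro x (rfl | rfl | rfl | rfl) <;>
      exact ⟨ne (by omega), by unfold Cross; omega⟩
  · unfold Cross; omega
  · unfold Cross; omega

end Blocks

/-! ### Marked points of a block pair are its empty chains. -/

section MarkedPointsOfBlocks

variable {A : Type*} {n : ℕ} {r s : A → ℕ}

/-- The map on positions that reverses, from position `k` on, blocks of the sizes listed in `L`. -/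
def reverseBlocks : List ℕ → ℕ → ℕ → ℕ
  | [], _, j => j
  | m :: L, k, j => if j < k then j else if j < k + m then 2 * k + m - 1 - j
      else reverseBlocks L (k + m) j

theorem reverseBlocks_of_lt {L : List ℕ} {k j : ℕ} (h : j < k) : reverseBlocks L k j = j := by
  cases L with
  | nil => rfl
  | cons m L => rw [reverseBlocks, if_pos h]

theorem reverseBlocks_of_ge {L : List ℕ} {k j : ℕ} (h : k + L.sum ≤ j) :
    reverseBlocks L k j = j := by
  induction L generalizing k with
  | nil => rfl
  | cons m L ih =>
    simp only [List.sum_cons] at h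
    rw [reverseBlocks, if_neg (by omega), if_neg (by omega), ih (by omega)]

theorem le_reverseBlocks {L : List ℕ} {k j : ℕ} (h : k ≤ j) : k ≤ reverseBlocks L k j := by
  induction L generalizing k with
  | nil => exact h
  | cons m L ih =>
    rw [reverseBlocks, if_neg (by omega)]
    split_ifs with h1
    · omega
    · have := ih (k := k + m) (by omega); omega

theorem reverseBlocks_self_iff {L : List ℕ} (hL : ∀ m ∈ L, 0 < m) (k : ℕ) :
    reverseBlocks L k k = k ↔ ∀ m ∈ L.head?, m = 1 := by
  cases L with
  | nil => simp [reverseBlocks]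
  | cons m L =>
    have := hL m List.mem_cons_self
    rw [reverseBlocks, if_neg (by omega), if_pos (by omega)]
    simp; omega

theorem ReversesBlocks.eq_reverseBlocks {L : List ℕ} {k : ℕ} (h : ReversesBlocks r s k L) {b : A}
    (h1 : k ≤ r b) (h2 : r b < k + L.sum) : s b = reverseBlocks L k (r b) := by
  induction L generalizing k with
  | nil => simp at h2; omega
  | cons m L ih =>
    simp only [List.sum_cons] at h2
    rw [reverseBlocks, if_neg (by omega)]
    split_ifs with h3
    · have := h.1 b h1 h3; omega
    · exact ih h.2 (by omega) (by omega)

/-- Two adjacent positions stay adjacent in order exactly when both are `1`-blocks, since larger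
blocks are reversed. The fixed positions just before and just after the blocks act as further
`1`-blocks; the separate summand accounts for the one before. Adjacent `1`-blocks enclose an empty
chain. -/
theorem card_filter_reverseBlocks {L : List ℕ} (hL : ∀ m ∈ L, 0 < m) (k : ℕ) :
    ((Finset.Ico k (k + L.sum)).filter fun i =>
        reverseBlocks L k (i + 1) = reverseBlocks L k i + 1).card +
      (if reverseBlocks L k k = k then 1 else 0) = (chains L).count [] := by
  induction L generalizing k with
  | nil => simp [reverseBlocks, chains]
  | cons m L ih =>
    have hm := hL m List.mem_cons_self
    have hL' : ∀ x ∈ L, 0 < x := fun x hx => hL x (List.mem_cons_of_mem _ hx)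
    have ih := ih hL' (k + m)
    have hi := reverseBlocks_self_iff hL' (k + m)
    have key : ((Finset.Ico k (k + (m :: L).sum)).filter fun i =>
        reverseBlocks (m :: L) k (i + 1) = reverseBlocks (m :: L) k i + 1).card =
        ((Finset.Ico (k + m) (k + m + L.sum)).filter fun i =>
          reverseBlocks L (k + m) (i + 1) = reverseBlocks L (k + m) i + 1).card +
        if m = 1 ∧ reverseBlocks L (k + m) (k + m) = k + m then 1 else 0 := by
      have e1 : Finset.Ico k (k + (m :: L).sum) =
          Finset.Ico k (k + m) ∪ Finset.Ico (k + m) (k + m + L.sum) := by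
        rw [Finset.Ico_union_Ico_eq_Ico (by omega) (by omega), List.sum_cons, add_assoc]
      rw [e1, Finset.filter_union, Finset.card_union_of_disjoint
        (Finset.disjoint_filter_filter (Finset.Ico_disjoint_Ico_consecutive _ _ _)), add_comm]
      congr 1
      · congr 1
        refine Finset.filter_congr fun i hi => ?_
        rw [Finset.mem_Ico] at hi
        rw [reverseBlocks, reverseBlocks, if_neg (by omega), if_neg (by omega), if_neg (by omega),
          if_neg (by omega)]
      · have inner : ∀ i ∈ Finset.Ico k (k + m),
            (reverseBlocks (m :: L) k (i + 1) = reverseBlocks (m :: L) k i + 1 ↔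
              i = k ∧ m = 1 ∧ reverseBlocks L (k + m) (k + m) = k + m) := by
          intro i hi
          rw [Finset.mem_Ico] at hi
          have hge := le_reverseBlocks (L := L) (le_refl (k + m))
          have e2 : reverseBlocks (m :: L) k i = 2 * k + m - 1 - i := by
            rw [reverseBlocks, if_neg (by omega), if_pos hi.2]
          rw [e2, reverseBlocks, if_neg (by omega)]
          by_cases h1 : i + 1 < k + m
          · rw [if_pos h1]; omega
          · rw [if_neg h1]
            rw [show i + 1 = k + m by omega]; omega
        rw [Finset.filter_congr inner]
        split_ifs with h1
        · rw [Finset.card_eq_one]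
          refine ⟨k, ?_⟩
          ext i; simp only [Finset.mem_filter, Finset.mem_Ico, Finset.mem_singleton]
          constructor
          · exact fun h => h.2.1
          · rintro rfl; exact ⟨by omega, rfl, h1⟩
        · rw [Finset.card_eq_zero]
          refine Finset.eq_empty_of_forall_notMem fun i hi => ?_
          exact h1 (Finset.mem_filter.1 hi).2.2
    have hself : reverseBlocks (m :: L) k k = k ↔ m = 1 := by
      rw [reverseBlocks_self_iff hL]; simp
    simp only [key, hself]
    by_cases h1 : m = 1
    · subst h1
      rw [chains_one_cons, List.count_cons_self, ← ih]
      simp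
    · obtain ⟨C, X, h2, h3⟩ := exists_chains_eq_cons L
      rw [← hi] at h3
      rw [chains_cons h1, h2]
      rw [h2, List.count_cons] at ih
      simp only [h1, false_and, if_false, List.modifyHead_cons]
      rw [List.count_cons]
      by_cases h4 : C = []
      · simp [h4, h3.1 h4] at ih ⊢; omega
      · simp [h4, mt h3.2 h4] at ih ⊢; omega

theorem IsBlockPair.markedPoints_eq [Finite A] {L : List ℕ} (h : IsBlockPair n r s L) :
    markedPoints n r s = (chains L).count [] := by
  classical
  obtain ⟨a, z, ra, sa, rz, sz⟩ := h.exists_outer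
  have hn := h.sum
  have haz : a ≠ z := by rintro rfl; omega
  -- `F` agrees with the second row on inner letters but fixes the positions 1 and `n`, where the
  -- second row exchanges the two outer letters.
  set F := reverseBlocks L 2 with hF
  have F1 : F 1 = 1 := reverseBlocks_of_lt (by omega)
  have Fn : F n = n := reverseBlocks_of_ge (by omega)
  have hFs : ∀ b, b ≠ a → b ≠ z → s b = F (r b) := by
    intro b hb hbz
    have := h.inner_lt (fun e => hb (h.row.inj (e.trans ra.symm)))
      (fun e => hbz (h.row.inj (e.trans rz.symm)))
    exact h.blocks.eq_reverseBlocks this.1 (by omega)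
  have ra' : ∀ {b}, r b = 1 → b = a := fun e => h.row.inj (e.trans ra.symm)
  have rz' : ∀ {b}, r b = n → b = z := fun e => h.row.inj (e.trans rz.symm)
  have sa' : ∀ {b}, s b = n → b = a := fun e => h.row'.inj (e.trans sa.symm)
  have sz' : ∀ {b}, s b = 1 → b = z := fun e => h.row'.inj (e.trans sz.symm)
  -- The joining in `Follows` makes `a` act as if it stood at position 1 of `s`. When the successor
  -- in `r` is `z`, the letter `a`, last in `s`, takes its place as follower.
  have follows : ∀ b c, r c = r b + 1 → ∀ d, (d = c ∧ c ≠ z ∨ d = a ∧ c = z) →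
      (Follows n r s b d ↔ F (r c) = F (r b) + 1) := by
    intro b c hbc d hd
    have hbz : b ≠ z := by
      rintro rfl; have := h.row.le c; omega
    have hca : c ≠ a := by
      rintro rfl; have := h.row.one_le b; omega
    have hf : Follows n r s b d ↔ s d = s b + 1 ∨ b = a ∧ s d = 2 := by
      unfold Follows
      refine or_congr_right (and_congr ⟨sa', fun e => e ▸ sa⟩ ?_)
      constructor
      · rintro ⟨y, hy, e⟩; rw [rz' hy, sz] at e; exact e
      · exact fun e => ⟨z, rz, by rw [e, sz]⟩
    have hd' : s d = F (r c) := by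
      rcases hd with ⟨rfl, hc⟩ | ⟨rfl, rfl⟩
      · exact hFs _ hca hc
      · rw [sa, rz, Fn]
    rw [hf, ← hd']
    by_cases hba : b = a
    · subst hba
      rw [ra, F1, sa]
      have := h.row'.le d; simp only [true_and]; omega
    · rw [← hFs b hba hbz]
      simp [hba]
  set G : Set A := {c | ∃ b, r c = r b + 1 ∧ F (r c) = F (r b) + 1} with hG
  have e1 : {c | ∃ b, r c = r b + 1 ∧ Follows n r s b c} = G \ {z} := by
    ext c
    simp only [hG, Set.mem_ofPred_eq, Set.mem_sdiff, Set.mem_singleton_iff]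
    constructor
    · rintro ⟨b, hb, hfo⟩
      have hcz : c ≠ z := by
        rintro rfl
        rcases hfo with h1 | ⟨h1, y, hy, h2⟩
        · have := h.row'.one_le b; omega
        · have := h.row'.one_le y; omega
      exact ⟨⟨b, hb, (follows b c hb c (Or.inl ⟨rfl, hcz⟩)).1 hfo⟩, hcz⟩
    · rintro ⟨⟨b, hb, hfo⟩, hcz⟩
      exact ⟨b, hb, (follows b c hb c (Or.inl ⟨rfl, hcz⟩)).2 hfo⟩
  have e2 : {b | ∃ x y, s x = 1 ∧ r y = 1 ∧ r x = r b + 1 ∧ Follows n r s b y}.ncard =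
      (G ∩ {z}).ncard := by
    have := ncard_exists_right_eq_ncard_exists_left
      (fun b c : A => c = z ∧ r c = r b + 1 ∧ F (r c) = F (r b) + 1)
      (fun b c c' h1 h2 => h1.1.trans h2.1.symm)
      (fun b b' c h1 h2 => h.row.inj (by omega))
    convert this using 2
    · ext b
      constructor
      · rintro ⟨x, y, h1, h2, h3, h4⟩
        rw [sz' h1] at h3
        rw [ra' h2] at h4
        exact ⟨z, rfl, h3, (follows b z h3 a (Or.inr ⟨rfl, rfl⟩)).1 h4⟩
      · rintro ⟨c, rfl, h3, h4⟩
        exact ⟨c, a, sz, ra, h3, (follows b c h3 a (Or.inr ⟨rfl, rfl⟩)).2 h4⟩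
    · ext c
      simp only [hG, Set.mem_inter_iff, Set.mem_ofPred_eq, Set.mem_singleton_iff]
      constructor
      · rintro ⟨⟨b, h1⟩, h2⟩; exact ⟨b, h2, h1⟩
      · rintro ⟨b, h2, h1⟩; exact ⟨⟨b, h1⟩, h2⟩
  have e3 : G.ncard = ((Finset.Ico 1 n).filter fun i => F (i + 1) = F i + 1).card := by
    rw [← Set.ncard_coe_finset]
    refine Set.ncard_congr (fun c _ => r c - 1) ?_ ?_ ?_
    · rintro c ⟨b, h1, h2⟩
      have := h.row.le c; have := h.row.one_le b
      simp only [Finset.coe_filter, Finset.mem_Ico, Set.mem_ofPred_eq]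
      rw [h1, Nat.add_sub_cancel, ← h1]
      exact ⟨by omega, h2⟩
    · intro c c' _ _ e
      have := h.row.one_le c; have := h.row.one_le c'
      exact h.row.inj (by omega)
    · intro i hi
      simp only [Finset.coe_filter, Finset.mem_Ico, Set.mem_ofPred_eq] at hi
      obtain ⟨b, hb⟩ := h.row.exists_eq (k := i) (by omega) (by omega)
      obtain ⟨c, hc⟩ := h.row.exists_eq (k := i + 1) (by omega) (by omega)
      refine ⟨c, ⟨b, by omega, by rw [hc, hb]; exact hi.2⟩, by omega⟩
  -- The position 1 is split off from the range; its condition F 2 = 2 is the extra summand in the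
  -- count of empty chains.
  rw [RPair.markedPoints_eq h.row h.row', e1, e2, add_comm, Set.ncard_inter_add_ncard_sdiff_eq_ncard,
    e3, ← card_filter_reverseBlocks h.pos 2, hn, ← Finset.insert_Ico_succ_left_eq_Ico (by omega),
    Finset.filter_insert]
  simp only [← hF, F1, Nat.succ_eq_succ, Nat.succ_eq_add_one, Nat.reduceAdd]
  split_ifs with h1
  · rw [Finset.card_insert_of_notMem (by simp)]
  · rfl

end MarkedPointsOfBlocks

end RPair

/-! ### Combining the three invariants. -/

theorem mainTheorem5 {A : Type*} [Fintype A] (p q : IrrPair A) (x y : ℕ)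
    (hq : q ∈ IrrPair.extendedRauzyClass p)
    (hx : p.1.HasType x) (hy : q.1.HasType y) : x = y := by
  obtain ⟨L, hp, hL⟩ := hx
  obtain ⟨L', hp', hL'⟩ := hy
  have bp := hp.isBlockPair
  have bq := hp'.isBlockPair
  have hsum := bp.sum.trans bq.sum.symm
  have hn : 2 ≤ Fintype.card A := by have := bp.sum; omega
  have hline := RPair.isLineGraph_iff_of_mem_extendedRauzyClass hn p q hq
  have hgauss := RPair.gaussSum_eq_of_mem_extendedRauzyClass hn p q hq
  have hmarked := RPair.markedPoints_eq_of_mem_extendedRauzyClass hn p q hq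
  rw [bp.gaussSum_univ, bq.gaussSum_univ] at hgauss
  rw [bp.markedPoints_eq, bq.markedPoints_eq] at hmarked
  have hprod : RPair.blockProduct L = RPair.blockProduct L' := by linarith
  have one_iff : x = 1 ↔ y = 1 := by
    constructor
    · rintro rfl
      by_contra hy
      exact bq.not_isLineGraph (hL'.manyBlocks hy) (hline.1 (bp.isLineGraph hL.count_le_one))
    · rintro rfl
      by_contra hx
      exact bp.not_isLineGraph (hL.manyBlocks hx) (hline.2 (bq.isLineGraph hL'.count_le_one))
  by_cases hx1 : x = 1
  · rw [hx1, one_iff.1 hx1]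
  have hy1 : y ≠ 1 := mt one_iff.2 hx1
  have sign : ∀ {x L}, RPair.TypeCondition x L → x ≠ 1 →
      (x = 2 ∧ 0 < RPair.blockProduct L) ∨ (x = 3 ∧ RPair.blockProduct L = 0) ∨
      ((x = 4 ∨ x = 5) ∧ RPair.blockProduct L < 0) := by
    intro x L h hx
    match x, h with
    | 2, h => exact Or.inl ⟨rfl, RPair.blockProduct_pos h.2⟩
    | 3, h =>
      obtain ⟨-, -, C, hC, m, l, rfl⟩ := h
      exact Or.inr (Or.inl ⟨rfl, RPair.blockProduct_eq_zero (RPair.mem_of_mem_chains hC (by simp))⟩)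
    | 4, h =>
      obtain ⟨u, v, h1, -⟩ := h.shape_four
      refine Or.inr (Or.inr ⟨Or.inl rfl, ?_⟩)
      rw [RPair.blockProduct_of_perm h1, show RPair.cliqueSum 4 1 = -4 by decide]
      have : (0 : ℤ) < 2 ^ (u + v) := by positivity
      linarith
    | 5, h =>
      obtain ⟨u, v, h1, -⟩ := h.shape_five
      refine Or.inr (Or.inr ⟨Or.inr rfl, ?_⟩)
      rw [RPair.blockProduct_of_perm h1, show RPair.cliqueSum 5 1 = -8 by decide]
      have : (0 : ℤ) < 2 ^ (u + v) := by positivity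
      linarith
  -- Different signs contradict the equality of the products, and equal signs settle Types 2 and 3;
  -- only the negative case remains.
  rcases sign hL hx1 with ⟨h1, h2⟩ | ⟨h1, h2⟩ | ⟨h1, h2⟩ <;>
    rcases sign hL' hy1 with ⟨h3, h4⟩ | ⟨h3, h4⟩ | ⟨h3, h4⟩ <;>
    first
    | (exfalso; linarith)
    | rw [h1, h3]
    | skip
  rcases h1 with rfl | rfl <;> rcases h3 with rfl | rfl
  · rfl
  · exact (RPair.not_typeCondition_four_and_five hL hL' (by omega) hprod hmarked).elim
  · exact (RPair.not_typeCondition_four_and_five hL' hL (by omega) hprod.symm hmarked.symm).elim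
  · rfl
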